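/- Let $k\ge 1$, let $s_2,s_3,\dots$ be non-negative integers, only finitely many of them non-zero, and let $\sigma_1,\sigma_2\in\mathfrak S(k)$ satisfy $\sigma_1\circ\sigma_2=(1,2,\dots,k)$. Write $C(\sigma)$ for the set of cycles of $\sigma$ (fixed points included). Let $\mathcal V=\mathcal V^{\sigma_1,\sigma_2}$ be the bipartite graph with white vertices $C(\sigma_1)$ and black vertices $C(\sigma_2)$ in which intersecting cycles are joined by an edge; either one takes a single edge for each pair of intersecting cycles, or one edge for each element of the common support (both conventions are covered). *Local transformations.* For an oriented loop (closed walk without repeated edges) $L$ of a subgraph $G$ of $\mathcal V$, let $E(L)$ be the set of edges of $L$ which are oriented from a black to a white vertex. The local transformation along $L$ replaces $G$ by the formal linear combination $\sum_{\emptyset\ne A\subseteq E(L)}(-1)^{|A|-1}\,(G\setminus A)$ of subgraphs with the same vertices. An *iteration* starts from $\mathcal V$, transforms the summands that appear along arbitrarily chosen loops, and stops when only forests are left; its result is a formal linear combination $S$ of forests. We say that $S$ has the *sign property* if every non-zero coefficient of a forest $F$ in $S$ has the sign $(-1)^{(\text{number of connected components of }F)-1}$. *Conditions.* For $q:C(\sigma_2)\to\{2,3,\dots\}$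 a *$q$-forest* is a forest $F\subseteq\mathcal V$ with all the vertices of $\mathcal V$ in which the black vertices lie in different connected components and each black vertex $c$ is a neighbour of exactly $q(c)-1$ white vertices. Consider the maps $q$ such that $|C(\sigma_2)|=\sum_i s_i$, $|C(\sigma_1)|+|C(\sigma_2)|=\sum_i i\,s_i$, and each colour $i\ge 2$ is used by $q$ exactly $s_i$ times. *Condition (e)*: for every $A\subset C(\sigma_2)$ with $A\ne\emptyset$ and $A\ne C(\sigma_2)$ there are more than $\sum_{c\in A}(q(c)-1)$ cycles of $\sigma_1$ which intersect $\bigcup A$. *Condition (e$^5$) for $S$*: there is exactly one $q$-forest in $S$ (that is, exactly one $q$-forest has a non-zero coefficient, and this coefficient is $\pm1$). Then: 1. For each such $q$ and for the result $S$ of an arbitrary iteration, the sum of the coefficients of the $q$-forests in $S$ is equal to $(-1)^{1+s_2+s_3+\cdots}$ if condition (e) is fulfilled, and to $0$ otherwise. 2. If moreover $S$ has the sign property (the property which Féray established for the choice of loops that he prescribes), then for each such $q$: if condition (e) is fulfilled, there is exactly one $q$-forest with non-zero coefficient in $S$, and its coefficient is $(-1)^{1+s_2+s_3+\cdots}$;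 if condition (e) is not fulfilled, there is no $q$-forest with non-zero coefficient in $S$. In other words, condition (e) is equivalent to condition (e$^5$) for $S$. 3. Iterations whose result has the sign property exist for every such $(\sigma_1,\sigma_2)$ (with loops chosen independently of $q$). -/

import Mathlib

/-- The cycles of a permutation (fixed points count as cycles of length one). -/
abbrev CycleOf {n : ℕ} (σ : Equiv.Perm (Fin n)) : Type :=
  Quotient (Equiv.Perm.SameCycle.setoid σ)

/-- The cycle of `σ` that contains `x`. -/
abbrev cycleAt {n : ℕ} (σ : Equiv.Perm (Fin n)) (x : Fin n) : CycleOf σ :=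
  Quotient.mk (Equiv.Perm.SameCycle.setoid σ) x

/-- A finite bipartite graph with set `W` of white vertices and set `B` of black vertices; multiple
edges are allowed.  A subgraph with the same set of vertices is given by its finite set of edges. -/
structure BipGraph (W B : Type) where
  /-- the edges -/
  E : Type
  [fintypeE : Fintype E]
  [decEqE : DecidableEq E]
  /-- the white endpoint of an edge -/
  white : E → W
  /-- the black endpoint of an edge -/
  black : E → B

attribute [instance] BipGraph.fintypeE BipGraph.decEqE

namespace BipGraph

variable {W B : Type} (V : BipGraph W B)

/-- An oriented loop of length `2 * (n + 1)` in the subgraph with edge set `G`: a closed walk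
without repeated edges.  Its edges are, in this order, `down 0, up 0, down 1, up 1, …`, where
`down i` is traversed from its black to its white endpoint and `up i` from its white to its
black endpoint (indices are cyclic). -/
structure OrientedLoop (G : Finset V.E) (n : ℕ) where
  /-- the edges oriented from a black vertex to a white vertex -/
  down : Fin (n + 1) → V.E
  /-- the edges oriented from a white vertex to a black vertex -/
  up : Fin (n + 1) → V.E
  down_mem : ∀ i, down i ∈ G
  up_mem : ∀ i, up i ∈ G
  white_eq : ∀ i, V.white (down i) = V.white (up i)
  black_eq : ∀ i, V.black (up i) = V.black (down (i + 1))
  down_injective : Function.Injective down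
  up_injective : Function.Injective up
  down_ne_up : ∀ i j, down i ≠ up j

/-- The edges of an oriented loop that are oriented from a black vertex to a white vertex. -/
def OrientedLoop.blackToWhite {V : BipGraph W B} {G : Finset V.E} {n : ℕ}
    (L : V.OrientedLoop G n) : Finset V.E :=
  Finset.univ.image L.down

/-- A subgraph is a forest if it contains no loop. -/
def IsForest (F : Finset V.E) : Prop :=
  ∀ n : ℕ, IsEmpty (V.OrientedLoop F n)

/-- `V.IsDecomposition G S`: the formal linear combination `S` of subgraphs is a result of
iterating local transformations, starting from the graph `G`, until only forests are left.
The local transformation given by an oriented loop `L` replaces `G` by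
`∑ (-1) ^ (|A| - 1) (G \ A)`, where `A` runs over the non-empty sets of edges of `L` that are
oriented from black to white; each graph that appears is then transformed further,
along loops that may be chosen freely (and independently) each time. -/
inductive IsDecomposition : Finset V.E → (Finset V.E →₀ ℤ) → Prop
  | forest (F : Finset V.E) (hF : V.IsForest F) : IsDecomposition F (Finsupp.single F 1)
  | transform (G : Finset V.E) (n : ℕ) (L : V.OrientedLoop G n)
      (S : Finset V.E → (Finset V.E →₀ ℤ))
      (hS : ∀ A ⊆ L.blackToWhite, A.Nonempty → IsDecomposition (G \ A) (S A)) :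
      IsDecomposition G
        (∑ A ∈ L.blackToWhite.powerset.erase ∅, (-1 : ℤ) ^ (A.card - 1) • S A)

/-- The adjacency structure of the subgraph with edge set `G`, on all vertices. -/
def toSimpleGraph (G : Finset V.E) : SimpleGraph (W ⊕ B) :=
  SimpleGraph.fromRel fun x y => ∃ e ∈ G, x = Sum.inl (V.white e) ∧ y = Sum.inr (V.black e)

/-- The number of connected components of a subgraph (isolated vertices are components). -/
noncomputable def numComponents (G : Finset V.E) : ℕ :=
  Nat.card (V.toSimpleGraph G).ConnectedComponent

/-- `F` is a `q`-forest: a forest in which the black vertices lie in different connected components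
and each black vertex `b` has exactly `q b - 1` white neighbours. -/
def IsQForest (q : B → ℕ) (F : Finset V.E) : Prop :=
  V.IsForest F ∧
  (∀ b b' : B, (V.toSimpleGraph F).Reachable (Sum.inr b) (Sum.inr b') → b = b') ∧
  ∀ b : B, Nat.card {w : W // ∃ e ∈ F, V.white e = w ∧ V.black e = b} = q b - 1

open scoped Classical in
/-- The sum of the coefficients of the `q`-forests in a formal linear combination. -/
noncomputable def qForestSum (q : B → ℕ) (S : Finset V.E →₀ ℤ) : ℤ :=
  S.sum fun F a => if V.IsQForest q F then a else 0

/-- The sign property of a formal linear combination obtained from a connected graph: the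
coefficient of `F`, if it is not zero, has the sign `(-1) ^ (number of components of F - 1)`. -/
def HasSignProperty (S : Finset V.E →₀ ℤ) : Prop :=
  ∀ F, S F ≠ 0 → 0 < (-1 : ℤ) ^ (V.numComponents F - 1) * S F

end BipGraph

open scoped Classical in
/-- The bipartite graph of `σ₁, σ₂`: white vertices are the cycles of `σ₁`, black vertices the
cycles of `σ₂`, and there is one edge for each pair of intersecting cycles. -/
noncomputable def intersectionGraph {k : ℕ} (σ₁ σ₂ : Equiv.Perm (Fin k)) :
    BipGraph (CycleOf σ₁) (CycleOf σ₂) where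
  E := {p : CycleOf σ₁ × CycleOf σ₂ // ∃ x, cycleAt σ₁ x = p.1 ∧ cycleAt σ₂ x = p.2}
  fintypeE := Fintype.ofFinite _
  white p := p.1.1
  black p := p.1.2

/-- The version with multiple edges: one edge for each element of the common support of a
cycle of `σ₁` and a cycle of `σ₂`. -/
def intersectionMultigraph {k : ℕ} (σ₁ σ₂ : Equiv.Perm (Fin k)) :
    BipGraph (CycleOf σ₁) (CycleOf σ₂) where
  E := Fin k
  white := cycleAt σ₁
  black := cycleAt σ₂

/-- Conditions (a)–(d) on `(σ₁, σ₂, q)`, for the monomial `R₂ ^ s₂ * R₃ ^ s₃ * ⋯`.  Here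
`finRotate k` is the long cycle `(1, 2, …, k)`. -/
structure IsColoredFactorization {k : ℕ} (s : ℕ →₀ ℕ) (σ₁ σ₂ : Equiv.Perm (Fin k))
    (q : CycleOf σ₂ → ℕ) : Prop where
  factorization : σ₁ * σ₂ = finRotate k
  card_black : Nat.card (CycleOf σ₂) = s.sum fun _ m => m
  card_total : Nat.card (CycleOf σ₁) + Nat.card (CycleOf σ₂) = s.sum fun i m => i * m
  two_le : ∀ c, 2 ≤ q c
  card_color : ∀ i, 2 ≤ i → Nat.card {c // q c = i} = s i

/-- Condition (e): for every non-trivial set `A` of cycles of `σ₂` there are more than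
`∑ i ∈ A, (q i - 1)` cycles of `σ₁` which intersect `⋃ A`. -/
def ConditionE {k : ℕ} (σ₁ σ₂ : Equiv.Perm (Fin k)) (q : CycleOf σ₂ → ℕ) : Prop :=
  ∀ A : Finset (CycleOf σ₂), A.Nonempty → (∃ c, c ∉ A) →
    ∑ i ∈ A, (q i - 1) <
      Nat.card {c : CycleOf σ₁ // ∃ x, cycleAt σ₁ x = c ∧ cycleAt σ₂ x ∈ A}

/-- In the formal linear combination `S` of subgraphs of `V` there is exactly one `q`-forest
(counted with the absolute value of its coefficient). -/
def ConditionE5 {W B : Type} (V : BipGraph W B) (q : B → ℕ) (S : Finset V.E →₀ ℤ) : Prop :=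
  ∃ F, V.IsQForest q F ∧ |S F| = 1 ∧ ∀ F', V.IsQForest q F' → S F' ≠ 0 → F' = F

/-!
Why the theorem is true.

Call a set of vertices of a subgraph `G` closed if it contains, with a black vertex, all its white
neighbours.  The closed sets form a ring of sets.  Fix integer weights of the vertices with total
weight zero.  The alternating sum `chainSum` over all chains of non-trivial closed sets of
non-positive weight is an invariant of the local transformations (`isInvariantAt_chainSum`): for
every single chain of sets, the graphs `G \ A` for which all its members are closed cancel, because
a chain cannot violate all edges of a loop from black to white and respect the other ones.  On the
other hand this invariant can be computed (`chainSum_eq`, `chainSum_closedSets`): it is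
`(-1) ^ (number of components - 1)` if every closed set has non-negative weight and only unions of
components have weight zero, and `0` otherwise.  In geometric terms the condition, `InRelint`, says
that the weight lies in the relative interior of the cone spanned by the vectors `w - b` for the
edges of `G`.  The proof adds relations between vertices until the closed sets are linearly ordered.

*Sums of coefficients.*  Give weight `1` to the white vertices and `1 - q b` to a black vertex `b`.
A forest satisfies `InRelint` if and only if it is a `q`-forest, and the whole graph does if and
only if condition (e) holds.  The invariant therefore yields the sum of the coefficients of the
`q`-forests (`IsDecomposition.qForestSum_eq`).  All `q`-forests have the same number of components,
so under the sign property their coefficients have the same sign, and a sum equal to `±1` or `0`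
leaves exactly one or no non-zero coefficient.

*Existence of iterations with the sign property.*  Fix an edge `e` and transform along loops
through `e`, oriented such that `e` is never removed, until no such loop is left.  Whatever loops
are chosen, the resulting linear combination is the same, since all its moments over supersets of a
set `Y` are determined (`IsPivotExpansion.sum_superset_eq`): they are given by another invariant,
which records whether the endpoints of `e` can be joined by a path whose steps from black to white
belong to `Y`, whereas those from white to black may use all of `G`.  It follows that only pivot
faces occur (`IsPivotExpansion.isPivotFace`); geometrically these are the cells of a pulling
subdivision, and their cones have disjoint relative interiors (`IsPivotFace.eq_of_inRelint`).  Hence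
the invariant `chainSum` for the sum of the edges of a face `H` isolates the coefficient of `H`
and determines its sign (`IsPivotExpansion.sign_pos`).  Expanding further with respect to other
edges keeps the signs and ends with forests (`exists_isDecomposition_sign`).
-/

set_option linter.unusedSectionVars false

/-! ### Rings of sets and alternating sums over chains -/

namespace SetRing

variable {α : Type*} [Fintype α] [DecidableEq α]

/-- The weight of a set: the sum of the weights of its elements. -/
def weight (a : α → ℤ) (I : Finset α) : ℤ := ∑ v ∈ I, a v

theorem weight_union_add_inter (a : α → ℤ) (I J : Finset α) :
    weight a (I ∪ J) + weight a (I ∩ J) = weight a I + weight a J :=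
  Finset.sum_union_inter

theorem weight_add_compl (a : α → ℤ) (I : Finset α) :
    weight a I + weight a Iᶜ = weight a Finset.univ :=
  Finset.sum_add_sum_compl I a

theorem weight_empty (a : α → ℤ) : weight a ∅ = 0 := Finset.sum_empty

/-- A ring of subsets of `α`: a family that contains `∅` and the whole set and is closed under
intersections and unions. -/
structure IsSetRing (D : Finset (Finset α)) : Prop where
  empty_mem : ∅ ∈ D
  univ_mem : Finset.univ ∈ D
  inter_mem : ∀ ⦃I⦄, I ∈ D → ∀ ⦃J⦄, J ∈ D → I ∩ J ∈ D
  union_mem : ∀ ⦃I⦄, I ∈ D → ∀ ⦃J⦄, J ∈ D → I ∪ J ∈ D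

/-- The members of `D` whose complement belongs to `D`, too. -/
def complemented (D : Finset (Finset α)) : Finset (Finset α) := D.filter fun I => Iᶜ ∈ D

/-- All members of `D` have non-negative weight, and the weight is zero only for complemented
members.  Geometrically: the functional `a` lies in the relative interior of the dual of the cone
spanned by the indicator functions of the members of `D`. -/
def InRelint (a : α → ℤ) (D : Finset (Finset α)) : Prop :=
  ∀ I ∈ D, 0 ≤ weight a I ∧ (weight a I = 0 → Iᶜ ∈ D)

open scoped Classical in
/-- The chains of non-trivial sets of non-positive weight. -/
noncomputable def admissibleChains (a : α → ℤ) : Finset (Finset (Finset α)) :=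
  Finset.univ.filter fun C => (∀ I ∈ C, ∀ J ∈ C, I ⊆ J ∨ J ⊆ I) ∧
    ∀ I ∈ C, I ≠ ∅ ∧ I ≠ Finset.univ ∧ weight a I ≤ 0

theorem mem_admissibleChains {a : α → ℤ} {C : Finset (Finset α)} :
    C ∈ admissibleChains a ↔ (∀ I ∈ C, ∀ J ∈ C, I ⊆ J ∨ J ⊆ I) ∧
      ∀ I ∈ C, I ≠ ∅ ∧ I ≠ Finset.univ ∧ weight a I ≤ 0 := by
  simp [admissibleChains]

/-- The (reduced, up to sign) Euler characteristic of the order complex of the non-trivial members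
of `D` of non-positive weight. -/
noncomputable def chainSum (a : α → ℤ) (D : Finset (Finset α)) : ℤ :=
  ∑ C ∈ admissibleChains a, if C ⊆ D then (-1) ^ C.card else 0

/-- The members of `D` that contain `v` if they contain `u`. -/
def imposed (D : Finset (Finset α)) (u v : α) : Finset (Finset α) :=
  D.filter fun I => u ∈ I → v ∈ I

theorem mem_imposed {D : Finset (Finset α)} {u v : α} {I : Finset α} :
    I ∈ imposed D u v ↔ I ∈ D ∧ (u ∈ I → v ∈ I) := Finset.mem_filter

theorem mem_complemented {D : Finset (Finset α)} {I : Finset α} :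
    I ∈ complemented D ↔ I ∈ D ∧ Iᶜ ∈ D := Finset.mem_filter

theorem imposed_comm (D : Finset (Finset α)) (u v : α) :
    imposed (imposed D u v) v u = imposed (imposed D v u) u v := by
  ext I; simp only [mem_imposed]; tauto

theorem IsSetRing.imposed {D : Finset (Finset α)} (hD : IsSetRing D) (u v : α) :
    IsSetRing (imposed D u v) where
  empty_mem := mem_imposed.2 ⟨hD.empty_mem, by simp⟩
  univ_mem := mem_imposed.2 ⟨hD.univ_mem, by simp⟩
  inter_mem I hI J hJ := by
    rw [mem_imposed] at *
    exact ⟨hD.inter_mem hI.1 hJ.1, by simp only [Finset.mem_inter]; tauto⟩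
  union_mem I hI J hJ := by
    rw [mem_imposed] at *
    exact ⟨hD.union_mem hI.1 hJ.1, by simp only [Finset.mem_union]; tauto⟩

/-- A chain in `D` cannot contain both a set that separates `u` from `v` and a set that
separates `v` from `u`; hence inclusion–exclusion. -/
theorem chainSum_imposed (a : α → ℤ) (D : Finset (Finset α)) (u v : α) :
    chainSum a D = chainSum a (imposed D u v) + chainSum a (imposed D v u)
      - chainSum a (imposed (imposed D u v) v u) := by
  classical
  unfold chainSum
  rw [← Finset.sum_add_distrib, ← Finset.sum_sub_distrib]
  refine Finset.sum_congr rfl fun C hC => ?_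
  have hchain := (mem_admissibleChains.1 hC).1
  by_cases h : C ⊆ D
  · have h1 : C ⊆ imposed D u v ↔ ∀ I ∈ C, u ∈ I → v ∈ I :=
      ⟨fun h' I hI => (mem_imposed.1 (h' hI)).2, fun h' I hI => mem_imposed.2 ⟨h hI, h' I hI⟩⟩
    have h2 : C ⊆ imposed D v u ↔ ∀ I ∈ C, v ∈ I → u ∈ I :=
      ⟨fun h' I hI => (mem_imposed.1 (h' hI)).2, fun h' I hI => mem_imposed.2 ⟨h hI, h' I hI⟩⟩
    have h3 : C ⊆ imposed (imposed D u v) v u ↔ C ⊆ imposed D u v ∧ C ⊆ imposed D v u := by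
      rw [h2]
      exact ⟨fun h' => ⟨fun I hI => (mem_imposed.1 (h' hI)).1,
        fun I hI => (mem_imposed.1 (h' hI)).2⟩,
        fun h' I hI => mem_imposed.2 ⟨h'.1 hI, h'.2 I hI⟩⟩
    have h4 : C ⊆ imposed D u v ∨ C ⊆ imposed D v u := by
      rw [h1, h2]
      by_contra! hcon
      obtain ⟨⟨I, hI, huI, hvI⟩, J, hJ, hvJ, huJ⟩ := hcon
      rcases hchain I hI J hJ with h | h
      · exact huJ (h huI)
      · exact hvI (h hvJ)
    rw [if_pos h]
    by_cases ha : C ⊆ imposed D u v <;> by_cases hb : C ⊆ imposed D v u <;> simp_all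
  · have hsub : ∀ u v, ¬ C ⊆ imposed D u v := fun u v h' => h (h'.trans (Finset.filter_subset _ _))
    have : ¬ C ⊆ imposed (imposed D u v) v u := fun h' =>
      hsub u v (h'.trans (Finset.filter_subset _ _))
    simp [h, hsub, this]

theorem mem_complemented_imposed {D : Finset (Finset α)} {u v : α} {I : Finset α} :
    I ∈ complemented (imposed D u v) ↔ I ∈ complemented D ∧ (u ∈ I ↔ v ∈ I) := by
  simp only [mem_complemented, mem_imposed, Finset.mem_compl]; tauto

theorem complemented_imposed_comm (D : Finset (Finset α)) (u v : α) :
    complemented (imposed D v u) = complemented (imposed D u v) := by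
  ext I; simp only [mem_complemented_imposed]; tauto

theorem complemented_imposed_imposed (D : Finset (Finset α)) (u v : α) :
    complemented (imposed (imposed D u v) v u) = complemented (imposed D u v) := by
  ext I; simp only [mem_complemented_imposed]; tauto

variable {D : Finset (Finset α)}

theorem compl_mem_complemented {I : Finset α} (hI : I ∈ complemented D) :
    Iᶜ ∈ complemented D := by
  rw [mem_complemented] at *; simpa using hI.symm

theorem IsSetRing.inter_mem_complemented (hD : IsSetRing D) {I J : Finset α}
    (hI : I ∈ complemented D) (hJ : J ∈ complemented D) : I ∩ J ∈ complemented D := by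
  rw [mem_complemented] at *
  exact ⟨hD.inter_mem hI.1 hJ.1, by rw [Finset.compl_inter]; exact hD.union_mem hI.2 hJ.2⟩

theorem IsSetRing.union_mem_complemented (hD : IsSetRing D) {I J : Finset α}
    (hI : I ∈ complemented D) (hJ : J ∈ complemented D) : I ∪ J ∈ complemented D := by
  rw [mem_complemented] at *
  exact ⟨hD.union_mem hI.1 hJ.1, by rw [Finset.compl_union]; exact hD.inter_mem hI.2 hJ.2⟩

/-- Complemented sets can be recognized on their meet and join with another set. -/
theorem IsSetRing.mem_complemented_of_inter_of_union (hD : IsSetRing D) {I J : Finset α}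
    (hI : I ∈ D) (hJ : J ∈ D) (h1 : I ∩ J ∈ complemented D) (h2 : I ∪ J ∈ complemented D) :
    I ∈ complemented D := by
  refine mem_complemented.2 ⟨hI, ?_⟩
  -- the complement of `I` is `(I ∪ J)ᶜ ∪ (J ∩ (I ∩ J)ᶜ)`
  have : Iᶜ = (I ∪ J)ᶜ ∪ (J ∩ (I ∩ J)ᶜ) := by
    ext x; simp only [Finset.mem_compl, Finset.mem_union, Finset.mem_inter]; tauto
  rw [this]
  exact hD.union_mem (mem_complemented.1 h2).2 (hD.inter_mem hJ (mem_complemented.1 h1).2)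

theorem inRelint_iff (a : α → ℤ) (D : Finset (Finset α)) :
    InRelint a D ↔ ∀ I ∈ D, 0 ≤ weight a I ∧ (weight a I = 0 → I ∈ complemented D) := by
  refine forall₂_congr fun I hI => ?_
  simp [mem_complemented, hI]

/-- A complemented set has weight zero, if all weights of members are non-negative and the total
weight is zero. -/
theorem InRelint.weight_eq_zero {a : α → ℤ} {D : Finset (Finset α)} (h : InRelint a D)
    (ha : weight a Finset.univ = 0) {I : Finset α} (hI : I ∈ complemented D) : weight a I = 0 := by
  have h1 := (h I (mem_complemented.1 hI).1).1
  have h2 := (h _ (mem_complemented.1 hI).2).1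
  have := weight_add_compl a I
  omega

/-- If no complemented set separates `u` from `v`, then the three refinements decide whether the
functional is in the relative interior. -/
theorem inRelint_iff_of_not_separated {a : α → ℤ} {D : Finset (Finset α)} (hD : IsSetRing D)
    {u v : α} (hsep : ∀ I ∈ complemented D, (u ∈ I ↔ v ∈ I)) :
    (InRelint a D ↔ InRelint a (imposed D u v) ∧ InRelint a (imposed D v u)) ∧
    (InRelint a (imposed (imposed D u v) v u) ↔
      InRelint a (imposed D u v) ∨ InRelint a (imposed D v u)) := by
  have e1 : complemented (imposed D u v) = complemented D := by
    ext I; rw [mem_complemented_imposed]; exact ⟨fun h => h.1, fun h => ⟨h, hsep I h⟩⟩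
  have e2 := (complemented_imposed_comm D u v).trans e1
  have e3 := (complemented_imposed_imposed D u v).trans e1
  simp only [inRelint_iff, e1, e2, e3]
  refine ⟨⟨fun h => ⟨fun I hI => h I (mem_imposed.1 hI).1, fun I hI => h I (mem_imposed.1 hI).1⟩,
    fun h I hI => ?_⟩, fun h => ?_, ?_⟩
  · by_cases huv : u ∈ I → v ∈ I
    · exact h.1 I (mem_imposed.2 ⟨hI, huv⟩)
    · exact h.2 I (mem_imposed.2 ⟨hI, by tauto⟩)
  · by_contra! hcon
    obtain ⟨⟨I, hI, hbI⟩, J, hJ, hbJ⟩ := hcon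
    rw [mem_imposed] at hI hJ
    have hI' : v ∈ I ∧ u ∉ I := by
      by_contra hc
      have := h I (by simp only [mem_imposed]; tauto)
      exact hbI this.1 |>.2 (this.2 (hbI this.1).1)
    have hJ' : u ∈ J ∧ v ∉ J := by
      by_contra hc
      have := h J (by simp only [mem_imposed]; tauto)
      exact hbJ this.1 |>.2 (this.2 (hbJ this.1).1)
    have h1 := h (I ∩ J) (by
      simp only [mem_imposed, Finset.mem_inter]
      exact ⟨⟨hD.inter_mem hI.1 hJ.1, by tauto⟩, by tauto⟩)
    have h2 := h (I ∪ J) (by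
      simp only [mem_imposed, Finset.mem_union]
      exact ⟨⟨hD.union_mem hI.1 hJ.1, by tauto⟩, by tauto⟩)
    have h3 := weight_union_add_inter a I J
    have hwI : weight a I ≤ 0 := by
      by_contra hc; exact absurd (hbI (by omega)).1 (by omega)
    have hwJ : weight a J ≤ 0 := by
      by_contra hc; exact absurd (hbJ (by omega)).1 (by omega)
    have := hD.mem_complemented_of_inter_of_union hI.1 hJ.1 (h1.2 (by omega)) (h2.2 (by omega))
    exact hI'.2 ((hsep I this).2 hI'.1)
  · rintro (h | h) I hI
    · exact h I (mem_imposed.1 hI).1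
    · rw [imposed_comm] at hI; exact h I (mem_imposed.1 hI).1

/-- If a complemented set separates `u` from `v`, then at most one of the three conditions holds,
and one of them holds if and only if the functional is in the relative interior for the common
refinement. -/
theorem inRelint_iff_of_separated {a : α → ℤ} {D : Finset (Finset α)} (hD : IsSetRing D)
    (ha : weight a Finset.univ = 0) {u v : α} {K : Finset α} (hK : K ∈ complemented D)
    (huK : u ∉ K) (hvK : v ∈ K) :
    (InRelint a (imposed (imposed D u v) v u) ↔
      InRelint a D ∨ InRelint a (imposed D u v) ∨ InRelint a (imposed D v u)) ∧
    ¬ (InRelint a D ∧ InRelint a (imposed D u v)) ∧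
    ¬ (InRelint a D ∧ InRelint a (imposed D v u)) ∧
    ¬ (InRelint a (imposed D u v) ∧ InRelint a (imposed D v u)) := by
  have hK1 : K ∈ imposed D u v := mem_imposed.2 ⟨(mem_complemented.1 hK).1, by tauto⟩
  have hK2 : Kᶜ ∈ imposed D v u := mem_imposed.2 ⟨(mem_complemented.1 hK).2, by simp [hvK]⟩
  have hn1 : K ∉ complemented (imposed D u v) := by
    rw [mem_complemented_imposed]; tauto
  have hn2 : Kᶜ ∉ complemented (imposed D v u) := by
    rw [mem_complemented_imposed]; simp only [Finset.mem_compl]; tauto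
  have hsum := weight_add_compl a K
  have e3 := complemented_imposed_imposed D u v
  have hmono : ∀ {I}, I ∈ complemented (imposed D u v) → I ∈ complemented D := fun h =>
    (mem_complemented_imposed.1 h).1
  refine ⟨⟨fun h => ?_, ?_⟩, fun h => ?_, fun h => ?_, fun h => ?_⟩
  · by_contra! hcon
    obtain ⟨hbD, hb1, hb2⟩ := hcon
    rw [inRelint_iff] at hbD hb1 hb2 h
    push Not at hb1 hb2
    obtain ⟨I, hI, hbI⟩ := hb1
    obtain ⟨J, hJ, hbJ⟩ := hb2
    rw [complemented_imposed_comm] at hbJ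
    rw [e3] at h
    rw [mem_imposed] at hI hJ
    have hI' : v ∈ I ∧ u ∉ I := by
      by_contra hc
      have := h I (by simp only [mem_imposed]; tauto)
      exact hbI this.1 |>.2 (this.2 (hbI this.1).1)
    have hJ' : u ∈ J ∧ v ∉ J := by
      by_contra hc
      have := h J (by simp only [mem_imposed]; tauto)
      exact hbJ this.1 |>.2 (this.2 (hbJ this.1).1)
    have hmem : ∀ {X}, X ∈ D → (u ∈ X ↔ v ∈ X) → X ∈ imposed (imposed D u v) v u := fun hX h =>
      mem_imposed.2 ⟨mem_imposed.2 ⟨hX, h.1⟩, h.2⟩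
    have h1 := h (I ∩ J) (hmem (hD.inter_mem hI.1 hJ.1) (by simp [hI', hJ']))
    have h2 := h (I ∪ J) (hmem (hD.union_mem hI.1 hJ.1) (by simp [hI', hJ']))
    have h3 := weight_union_add_inter a I J
    have hwI : weight a I ≤ 0 := by
      by_contra hc; exact absurd (hbI (by omega)).1 (by omega)
    have hwJ : weight a J ≤ 0 := by
      by_contra hc; exact absurd (hbJ (by omega)).1 (by omega)
    -- `I` is a complemented set of weight zero that separates `v` from `u`
    have hIc := hD.mem_complemented_of_inter_of_union hI.1 hJ.1 (hmono (h1.2 (by omega)))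
      (hmono (h2.2 (by omega)))
    have hIw : weight a I = 0 := by omega
    have hIcw : weight a Iᶜ = 0 := by have := weight_add_compl a I; omega
    -- a set that is modified by a complemented set of weight zero to one containing both or none
    have key : ∀ X ∈ D, ∀ T ∈ complemented D, weight a T = 0 →
        (u ∈ X ↔ u ∉ T) → (v ∈ X ↔ v ∉ T) →
        0 ≤ weight a X ∧ (weight a X = 0 → X ∈ complemented D) := by
      intro X hX T hT hTw h4 h5
      have hTD := (mem_complemented.1 hT).1
      have h6 := h (X ∩ T) (hmem (hD.inter_mem hX hTD) (by simp [h4, h5]))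
      have h7 := h (X ∪ T) (hmem (hD.union_mem hX hTD) (by
        simp [h4, h5, (Classical.em _).symm]))
      have h8 := weight_union_add_inter a X T
      exact ⟨by omega, fun h0 => hD.mem_complemented_of_inter_of_union hX hTD
        (hmono (h6.2 (by omega))) (hmono (h7.2 (by omega)))⟩
    refine hbD fun X hX => ?_
    by_cases hXu : u ∈ X <;> by_cases hXv : v ∈ X
    · have := h X (hmem hX (by simp [hXu, hXv])); exact ⟨this.1, fun h0 => hmono (this.2 h0)⟩
    · exact key X hX I hIc hIw (by simp [hXu, hI']) (by simp [hXv, hI'])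
    · exact key X hX Iᶜ (compl_mem_complemented hIc) hIcw (by simp [hXu, hI'])
        (by simp [hXv, hI'])
    · have := h X (hmem hX (by simp [hXu, hXv])); exact ⟨this.1, fun h0 => hmono (this.2 h0)⟩
  · simp only [inRelint_iff, e3, complemented_imposed_comm D u v]
    rintro (h | h | h) I hI
    · have hI' := mem_imposed.1 (mem_imposed.1 hI).1
      refine ⟨(h I hI'.1).1, fun h0 => mem_complemented_imposed.2 ⟨(h I hI'.1).2 h0, hI'.2, ?_⟩⟩
      exact (mem_imposed.1 hI).2
    · exact h I (mem_imposed.1 hI).1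
    · rw [imposed_comm] at hI; exact h I (mem_imposed.1 hI).1
  · exact hn1 (((inRelint_iff _ _).1 h.2 K hK1).2 (h.1.weight_eq_zero ha hK))
  · exact hn2 (((inRelint_iff _ _).1 h.2 _ hK2).2
      (h.1.weight_eq_zero ha (compl_mem_complemented hK)))
  · have h1 := (inRelint_iff _ _).1 h.1 K hK1
    have h2 := (inRelint_iff _ _).1 h.2 _ hK2
    have h3 : weight a K ≠ 0 := fun h0 => hn1 (h1.2 h0)
    have := h1.1
    have := h2.1
    omega

/-- A complemented set `K` that separates `u` from `v` exchanges, by symmetric difference, the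
complemented sets that separate `u` from `v` and those that do not. -/
theorem card_complemented_of_separated {D : Finset (Finset α)} (hD : IsSetRing D)
    {u v : α} {K : Finset α} (hK : K ∈ complemented D) (huK : u ∉ K) (hvK : v ∈ K) :
    (complemented D).card = 2 * (complemented (imposed D u v)).card := by
  have e : complemented (imposed D u v) = (complemented D).filter fun I => (u ∈ I ↔ v ∈ I) := by
    ext I; rw [mem_complemented_imposed, Finset.mem_filter]
  rw [← Finset.card_filter_add_card_filter_not (s := complemented D) (fun I => (u ∈ I ↔ v ∈ I)),
    e, two_mul]
  congr 1
  have hsymm : ∀ I ∈ complemented D, symmDiff I K ∈ complemented D := fun I hI => by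
    have : symmDiff I K = (I ∩ Kᶜ) ∪ (K ∩ Iᶜ) := by
      ext x; simp only [Finset.mem_symmDiff, Finset.mem_union, Finset.mem_inter, Finset.mem_compl]
    rw [this]
    exact hD.union_mem_complemented (hD.inter_mem_complemented hI (compl_mem_complemented hK))
      (hD.inter_mem_complemented hK (compl_mem_complemented hI))
  refine Finset.card_nbij' (fun I => symmDiff I K) (fun I => symmDiff I K) ?_ ?_ ?_ ?_
  · intro I hI
    simp only [Finset.coe_filter, Set.mem_ofPred_eq] at hI ⊢
    exact ⟨hsymm I hI.1, by simp only [Finset.mem_symmDiff]; tauto⟩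
  · intro I hI
    simp only [Finset.coe_filter, Set.mem_ofPred_eq] at hI ⊢
    exact ⟨hsymm I hI.1, by simp only [Finset.mem_symmDiff]; tauto⟩
  · intro I _; exact symmDiff_symmDiff_cancel_right K I
  · intro I _; exact symmDiff_symmDiff_cancel_right K I

/-- If the ring of sets is a chain, then the chain sum is an alternating sum over the power set of
its non-trivial members of non-positive weight. -/
theorem chainSum_of_chain {a : α → ℤ} {D : Finset (Finset α)} (hD : IsSetRing D)
    (ha : weight a Finset.univ = 0) (hchain : ∀ I ∈ D, ∀ J ∈ D, I ⊆ J ∨ J ⊆ I)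
    [Nonempty α] [Decidable (InRelint a D)] :
    (complemented D).card = 2 ∧ chainSum a D = if InRelint a D then 1 else 0 := by
  classical
  have hne : (∅ : Finset α) ≠ Finset.univ := Finset.univ_nonempty.ne_empty.symm
  have hcomp : complemented D = {∅, Finset.univ} := by
    ext I
    simp only [mem_complemented, Finset.mem_insert, Finset.mem_singleton]
    refine ⟨fun h => ?_, ?_⟩
    · rcases hchain I h.1 _ h.2 with h' | h'
      · left; exact Finset.eq_empty_of_forall_notMem fun x hx => by simpa [hx] using h' hx
      · right; exact Finset.eq_univ_of_forall fun x => by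
          by_contra hx; exact hx (h' (Finset.mem_compl.2 hx))
    · rintro (rfl | rfl)
      · simpa using ⟨hD.empty_mem, hD.univ_mem⟩
      · simpa using ⟨hD.univ_mem, hD.empty_mem⟩
  refine ⟨by rw [hcomp, Finset.card_pair hne], ?_⟩
  set P := D.filter fun I => I ≠ ∅ ∧ I ≠ Finset.univ ∧ weight a I ≤ 0 with hP
  have h1 : chainSum a D = ∑ C ∈ P.powerset, (-1) ^ C.card := by
    unfold chainSum
    rw [← Finset.sum_filter]
    refine Finset.sum_congr ?_ fun _ _ => rfl
    ext C
    simp only [Finset.mem_filter, mem_admissibleChains, Finset.mem_powerset, hP, Finset.subset_iff]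
    refine ⟨fun h I hI => ⟨h.2 hI, h.1.2 I hI⟩, fun h => ⟨⟨fun I hI J hJ => ?_,
      fun I hI => (h hI).2⟩, fun I hI => (h hI).1⟩⟩
    exact hchain I (h hI).1 J (h hJ).1
  rw [h1, Finset.sum_powerset_neg_one_pow_card]
  congr 1
  rw [inRelint_iff, hcomp, eq_iff_iff, hP, Finset.filter_eq_empty_iff]
  refine forall₂_congr fun I hI => ?_
  simp only [Finset.mem_insert, Finset.mem_singleton]
  constructor
  · intro h
    by_cases h0 : I = ∅
    · subst h0; simp [weight_empty]
    by_cases h1 : I = Finset.univ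
    · subst h1; simp [ha]
    have : ¬ weight a I ≤ 0 := fun h2 => h ⟨h0, h1, h2⟩
    exact ⟨by omega, fun h => absurd h.le this⟩
  · rintro h ⟨h0, h1, h2⟩
    rcases h.2 (le_antisymm h2 h.1) with h | h <;> contradiction

open scoped Classical in
/-- The chain sum detects the relative interior.  The proof adds relations `u ∈ I ↔ v ∈ I` and
`u ∈ I → v ∈ I` until the ring of sets is a chain. -/
theorem chainSum_eq {a : α → ℤ} (ha : weight a Finset.univ = 0) [Nonempty α] :
    ∀ (D : Finset (Finset α)), IsSetRing D → ∀ c : ℕ, (complemented D).card = 2 ^ (c + 1) →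
      chainSum a D = if InRelint a D then (-1) ^ c else 0 := by
  intro D
  induction D using Finset.strongInduction with
  | H D ih =>
  intro hD c hc
  by_cases hchain : ∀ I ∈ D, ∀ J ∈ D, I ⊆ J ∨ J ⊆ I
  · obtain ⟨h1, h2⟩ := chainSum_of_chain hD ha hchain
    rw [h1] at hc
    have : c = 0 := by
      by_contra h0
      have : 2 ^ 1 < 2 ^ (c + 1) := Nat.pow_lt_pow_right (by norm_num) (by omega)
      omega
    rw [h2, this, pow_zero]
  · push Not at hchain
    obtain ⟨I, hI, J, hJ, hIJ, hJI⟩ := hchain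
    obtain ⟨v, hvI, hvJ⟩ := Finset.not_subset.1 hIJ
    obtain ⟨u, huJ, huI⟩ := Finset.not_subset.1 hJI
    have s1 : imposed D u v ⊂ D := (Finset.filter_ssubset).2 ⟨J, hJ, by tauto⟩
    have s2 : imposed D v u ⊂ D := (Finset.filter_ssubset).2 ⟨I, hI, by tauto⟩
    have s3 : imposed (imposed D u v) v u ⊂ D :=
      lt_of_le_of_lt (Finset.filter_subset _ _) s1
    have r1 := hD.imposed u v
    have r2 := hD.imposed v u
    have r3 := r1.imposed v u
    rw [chainSum_imposed a D u v]
    by_cases hsep : ∀ I ∈ complemented D, (u ∈ I ↔ v ∈ I)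
    · have e1 : complemented (imposed D u v) = complemented D := by
        ext I; rw [mem_complemented_imposed]; exact ⟨fun h => h.1, fun h => ⟨h, hsep I h⟩⟩
      rw [ih _ s1 r1 c (by rw [e1, hc]), ih _ s2 r2 c (by rw [complemented_imposed_comm, e1, hc]),
        ih _ s3 r3 c (by rw [complemented_imposed_imposed, e1, hc])]
      obtain ⟨h1, h2⟩ := inRelint_iff_of_not_separated (a := a) hD hsep
      by_cases k1 : InRelint a (imposed D u v) <;> by_cases k2 : InRelint a (imposed D v u) <;>
        simp [h1, h2, k1, k2]
    · obtain ⟨K, hK, huK, hvK⟩ : ∃ K ∈ complemented D, u ∉ K ∧ v ∈ K := by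
        push Not at hsep
        obtain ⟨K, hK, h⟩ := hsep
        rcases h with h | h
        · exact ⟨Kᶜ, compl_mem_complemented hK, by simpa using h.1, by simpa using h.2⟩
        · exact ⟨K, hK, h.1, h.2⟩
      have hcard := card_complemented_of_separated hD hK huK hvK
      have hpos : 1 < (complemented (imposed D u v)).card := by
        refine Finset.one_lt_card.2 ⟨∅, ?_, Finset.univ, ?_, Finset.univ_nonempty.ne_empty.symm⟩
        · exact mem_complemented.2 ⟨r1.empty_mem, by simpa using r1.univ_mem⟩
        · exact mem_complemented.2 ⟨r1.univ_mem, by simpa using r1.empty_mem⟩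
      obtain ⟨c, rfl⟩ : ∃ d, c = d + 1 := by
        refine ⟨c - 1, ?_⟩
        rcases c with _ | c
        · rw [hcard] at hc; omega
        · omega
      have e1 : (complemented (imposed D u v)).card = 2 ^ (c + 1) := by
        rw [hcard, pow_succ 2 (c + 1)] at hc; omega
      rw [ih _ s1 r1 c e1, ih _ s2 r2 c (by rw [complemented_imposed_comm, e1]),
        ih _ s3 r3 c (by rw [complemented_imposed_imposed, e1])]
      obtain ⟨h1, h2, h3, h4⟩ := inRelint_iff_of_separated (a := a) hD ha hK huK hvK
      by_cases k : InRelint a D <;> by_cases k1 : InRelint a (imposed D u v) <;>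
        by_cases k2 : InRelint a (imposed D v u) <;> simp_all [pow_succ]

end SetRing

/-! ### Invariants of local transformations -/

/-- An alternating sum over the subsets of `T` vanishes if the summand does not notice whether a
fixed element of `T` is present. -/
theorem sum_powerset_neg_one_pow_eq_zero_of_insert {ι : Type*} [DecidableEq ι] {T : Finset ι}
    {g : ι} (hg : g ∈ T) (φ : Finset ι → ℤ)
    (h : ∀ A ⊆ T, g ∉ A → φ (insert g A) = φ A) :
    ∑ A ∈ T.powerset, (-1) ^ A.card * φ A = 0 := by
  rw [← Finset.insert_erase hg, Finset.sum_powerset_insert (Finset.notMem_erase g T),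
    ← Finset.sum_add_distrib]
  refine Finset.sum_eq_zero fun A hA => ?_
  have hA := Finset.mem_powerset.1 hA
  have hgA : g ∉ A := fun h => Finset.notMem_erase g T (hA h)
  rw [h A (hA.trans (Finset.erase_subset _ _)) hgA, Finset.card_insert_of_notMem hgA, pow_succ]
  ring

namespace BipGraph

open SetRing

variable {W B : Type} (V : BipGraph W B)

/-- A function on subgraphs is invariant under the local transformation along `L`. -/
def IsInvariantAt (Φ : Finset V.E → ℤ) {G : Finset V.E} {n : ℕ} (L : V.OrientedLoop G n) : Prop :=
  ∑ A ∈ L.blackToWhite.powerset, (-1) ^ A.card * Φ (G \ A) = 0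

variable {V}

theorem IsInvariantAt.eq_sum {Φ : Finset V.E → ℤ} {G : Finset V.E} {n : ℕ}
    {L : V.OrientedLoop G n} (h : V.IsInvariantAt Φ L) :
    Φ G = ∑ A ∈ L.blackToWhite.powerset.erase ∅, (-1) ^ (A.card - 1) * Φ (G \ A) := by
  unfold IsInvariantAt at h
  rw [← Finset.add_sum_erase _ _ (Finset.empty_mem_powerset _)] at h
  simp only [Finset.card_empty, pow_zero, Finset.sdiff_empty, one_mul] at h
  rw [eq_neg_of_add_eq_zero_left h, ← Finset.sum_neg_distrib]
  refine Finset.sum_congr rfl fun A hA => ?_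
  have : A.card ≠ 0 := Finset.card_ne_zero.2
    (Finset.nonempty_iff_ne_empty.2 (Finset.mem_erase.1 hA).1)
  obtain ⟨m, hm⟩ := Nat.exists_eq_succ_of_ne_zero this
  rw [hm, Nat.succ_sub_one, pow_succ]; ring

/-- Evaluation of a formal linear combination is linear. -/
theorem sum_smul_finset {ι : Type*} (Φ : Finset V.E → ℤ) (T : Finset ι) (c : ι → ℤ)
    (S : ι → (Finset V.E →₀ ℤ)) :
    (∑ A ∈ T, c A • S A).sum (fun F x => x * Φ F) =
      ∑ A ∈ T, c A * (S A).sum fun F x => x * Φ F := by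
  rw [← Finsupp.sum_finsetSum_index (by simp) (by intros; ring)]
  refine Finset.sum_congr rfl fun A _ => ?_
  rw [Finsupp.sum_smul_index (by simp), Finsupp.mul_sum]
  exact Finsupp.sum_congr fun _ _ => by ring

theorem OrientedLoop.down_mem_blackToWhite {G : Finset V.E} {n : ℕ} (L : V.OrientedLoop G n)
    (i : Fin (n + 1)) : L.down i ∈ L.blackToWhite :=
  Finset.mem_image_of_mem _ (Finset.mem_univ i)

theorem OrientedLoop.blackToWhite_subset {G : Finset V.E} {n : ℕ} (L : V.OrientedLoop G n) :
    L.blackToWhite ⊆ G := by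
  intro x hx
  obtain ⟨i, _, rfl⟩ := Finset.mem_image.1 hx
  exact L.down_mem i

theorem OrientedLoop.up_mem_sdiff {G : Finset V.E} {n : ℕ} (L : V.OrientedLoop G n)
    (i : Fin (n + 1)) {A : Finset V.E} (hA : A ⊆ L.blackToWhite) : L.up i ∈ G \ A := by
  refine Finset.mem_sdiff.2 ⟨L.up_mem i, fun h => ?_⟩
  obtain ⟨j, _, hj⟩ := Finset.mem_image.1 (hA h)
  exact L.down_ne_up j i hj

/-- Invariants of local transformations can be evaluated on the result of an iteration. -/
theorem IsDecomposition.sum_eq {Φ : Finset V.E → ℤ}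
    (hΦ : ∀ (G : Finset V.E) (n : ℕ) (L : V.OrientedLoop G n), V.IsInvariantAt Φ L)
    {G : Finset V.E} {S : Finset V.E →₀ ℤ} (h : V.IsDecomposition G S) :
    S.sum (fun F x => x * Φ F) = Φ G := by
  induction h with
  | forest F hF => simp
  | transform G n L S hS ih =>
    rw [sum_smul_finset, (hΦ G n L).eq_sum]
    refine Finset.sum_congr rfl fun A hA => ?_
    rw [ih A (Finset.mem_powerset.1 (Finset.mem_erase.1 hA).2)
      (Finset.nonempty_iff_ne_empty.2 (Finset.mem_erase.1 hA).1)]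

/-- Only forests occur in the result of an iteration. -/
theorem IsDecomposition.isForest {G : Finset V.E} {S : Finset V.E →₀ ℤ}
    (h : V.IsDecomposition G S) {F : Finset V.E} (hF : S F ≠ 0) : V.IsForest F := by
  induction h with
  | forest F' hF' =>
    rw [Finsupp.single_apply] at hF
    split_ifs at hF with h
    · exact h ▸ hF'
    · exact absurd rfl hF
  | transform G n L S hS ih =>
    rw [Finsupp.finsetSum_apply] at hF
    obtain ⟨A, hA, h⟩ := Finset.exists_ne_zero_of_sum_ne_zero hF
    rw [Finsupp.smul_apply, smul_eq_mul] at h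
    exact ih A (Finset.mem_powerset.1 (Finset.mem_erase.1 hA).2)
      (Finset.nonempty_iff_ne_empty.2 (Finset.mem_erase.1 hA).1) (right_ne_zero_of_mul h)

section closed

variable (V) [Fintype W] [Fintype B] [DecidableEq W] [DecidableEq B]

/-- The sets of vertices which contain, with a black vertex, all its white neighbours in `G`. -/
def closedSets (G : Finset V.E) : Finset (Finset (W ⊕ B)) :=
  Finset.univ.filter fun I => ∀ e ∈ G, Sum.inr (V.black e) ∈ I → Sum.inl (V.white e) ∈ I

variable {V}

theorem mem_closedSets {G : Finset V.E} {I : Finset (W ⊕ B)} :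
    I ∈ V.closedSets G ↔ ∀ e ∈ G, Sum.inr (V.black e) ∈ I → Sum.inl (V.white e) ∈ I := by
  simp [closedSets]

theorem isSetRing_closedSets (G : Finset V.E) : IsSetRing (V.closedSets G) where
  empty_mem := mem_closedSets.2 fun e _ h => absurd h (Finset.notMem_empty _)
  univ_mem := mem_closedSets.2 fun e _ _ => Finset.mem_univ _
  inter_mem I hI J hJ := by
    rw [mem_closedSets] at *
    intro e he h
    rw [Finset.mem_inter] at *
    exact ⟨hI e he h.1, hJ e he h.2⟩
  union_mem I hI J hJ := by
    rw [mem_closedSets] at *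
    intro e he h
    rw [Finset.mem_union] at *
    exact h.imp (hI e he) (hJ e he)

theorem mem_complemented_closedSets {G : Finset V.E} {I : Finset (W ⊕ B)} :
    I ∈ complemented (V.closedSets G) ↔
      ∀ e ∈ G, (Sum.inr (V.black e) ∈ I ↔ Sum.inl (V.white e) ∈ I) := by
  rw [mem_complemented, mem_closedSets, mem_closedSets]
  simp only [Finset.mem_compl, not_imp_not]
  exact ⟨fun h e he => ⟨h.1 e he, h.2 e he⟩, fun h => ⟨fun e he => (h e he).1,
    fun e he => (h e he).2⟩⟩

/-- The chain sum of the closed sets is an invariant of the local transformations: a chain of sets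
cannot violate all edges of the loop from black to white and respect all other ones. -/
theorem isInvariantAt_chainSum (a : W ⊕ B → ℤ) {G : Finset V.E} {n : ℕ} (L : V.OrientedLoop G n) :
    V.IsInvariantAt (fun G => chainSum a (V.closedSets G)) L := by
  unfold IsInvariantAt chainSum
  simp only [Finset.mul_sum]
  rw [Finset.sum_comm]
  refine Finset.sum_eq_zero fun C hC => ?_
  have hchain := (mem_admissibleChains.1 hC).1
  by_cases hup : C ⊆ V.closedSets (G \ L.blackToWhite)
  swap
  · refine Finset.sum_eq_zero fun A hA => ?_
    rw [if_neg, mul_zero]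
    refine fun h => hup (h.trans fun I hI => mem_closedSets.2 fun e he => ?_)
    exact mem_closedSets.1 hI e (Finset.sdiff_subset_sdiff le_rfl (Finset.mem_powerset.1 hA) he)
  obtain ⟨i, hi⟩ : ∃ i, ∀ I ∈ C, Sum.inr (V.black (L.down i)) ∈ I →
      Sum.inl (V.white (L.down i)) ∈ I := by
    by_contra! hcon
    choose I hIC hb hw using hcon
    -- the sets that violate the edges `L.down i` would increase strictly around the loop
    have hlt : ∀ i, I i ⊂ I (i + 1) := by
      intro i
      have hb' : Sum.inr (V.black (L.down (i + 1))) ∉ I i := by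
        rw [← L.black_eq]
        intro h
        apply hw i
        rw [L.white_eq]
        exact mem_closedSets.1 (hup (hIC i)) _ (L.up_mem_sdiff i le_rfl) h
      have hnot : ¬ I (i + 1) ⊆ I i := fun h => hb' (h (hb (i + 1)))
      exact ⟨(hchain _ (hIC i) _ (hIC (i + 1))).resolve_right hnot, hnot⟩
    obtain ⟨j, -, hj⟩ := Finset.exists_max_image Finset.univ (fun i => (I i).card)
      Finset.univ_nonempty
    exact absurd (hj (j + 1) (Finset.mem_univ _)) (not_le.2 (Finset.card_lt_card (hlt j)))
  refine sum_powerset_neg_one_pow_eq_zero_of_insert (L.down_mem_blackToWhite i) _ fun A hA hiA => ?_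
  have : C ⊆ V.closedSets (G \ insert (L.down i) A) ↔ C ⊆ V.closedSets (G \ A) := by
    constructor <;> intro h I hI <;> rw [mem_closedSets] <;> intro e he
    · by_cases hei : e = L.down i
      · subst hei; exact hi I hI
      · exact mem_closedSets.1 (h hI) e (by simp_all)
    · exact mem_closedSets.1 (h hI) e (by simp_all)
  simp only [this]

theorem toSimpleGraph_adj {F : Finset V.E} {e : V.E} (he : e ∈ F) :
    (V.toSimpleGraph F).Adj (Sum.inl (V.white e)) (Sum.inr (V.black e)) := by
  rw [toSimpleGraph, SimpleGraph.fromRel_adj]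
  exact ⟨Sum.inl_ne_inr, Or.inl ⟨e, he, rfl, rfl⟩⟩

theorem reachable_iff_of_mem_complemented {F : Finset V.E} {I : Finset (W ⊕ B)}
    (hI : I ∈ complemented (V.closedSets F)) {x y : W ⊕ B}
    (h : (V.toSimpleGraph F).Reachable x y) : x ∈ I ↔ y ∈ I := by
  rw [SimpleGraph.reachable_iff_reflTransGen] at h
  induction h with
  | refl => rfl
  | tail _ h ih =>
    refine ih.trans ?_
    rw [toSimpleGraph, SimpleGraph.fromRel_adj] at h
    rcases h.2 with ⟨e, he, rfl, rfl⟩ | ⟨e, he, rfl, rfl⟩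
    · exact (mem_complemented_closedSets.1 hI e he).symm
    · exact mem_complemented_closedSets.1 hI e he

/-- The complemented closed sets are the unions of components. -/
theorem card_complemented_closedSets (G : Finset V.E) :
    (complemented (V.closedSets G)).card = 2 ^ V.numComponents G := by
  classical
  have hfin : Finite (V.toSimpleGraph G).ConnectedComponent := inferInstance
  have := Fintype.ofFinite (V.toSimpleGraph G).ConnectedComponent
  rw [numComponents, Nat.card_eq_fintype_card, ← Finset.card_univ, ← Finset.card_powerset]
  refine Finset.card_nbij'
    (fun I => Finset.univ.filter fun c => ∃ x ∈ I, (V.toSimpleGraph G).connectedComponentMk x = c)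
    (fun T => Finset.univ.filter fun x => (V.toSimpleGraph G).connectedComponentMk x ∈ T)
    (fun _ _ => by simp) ?_ ?_ ?_
  · intro T _
    rw [Finset.mem_coe, mem_complemented_closedSets]
    intro e he
    simp [SimpleGraph.ConnectedComponent.sound (toSimpleGraph_adj he).reachable]
  · intro I hI
    ext x
    simp only [Finset.mem_filter, Finset.mem_univ, true_and, SimpleGraph.ConnectedComponent.eq]
    exact ⟨fun ⟨y, hy, h⟩ => (reachable_iff_of_mem_complemented hI h).1 hy,
      fun h => ⟨x, h, SimpleGraph.Reachable.rfl⟩⟩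
  · intro T _
    ext c
    induction c using SimpleGraph.ConnectedComponent.ind with
    | h x =>
      simp only [Finset.mem_filter, Finset.mem_univ, true_and]
      exact ⟨fun ⟨y, hy, h⟩ => h ▸ hy, fun h => ⟨x, h, rfl⟩⟩

theorem numComponents_pos [Nonempty B] (G : Finset V.E) : 0 < V.numComponents G := by
  have : Nonempty (V.toSimpleGraph G).ConnectedComponent :=
    (inferInstance : Nonempty (W ⊕ B)).map (V.toSimpleGraph G).connectedComponentMk
  exact Nat.card_pos

open scoped Classical in
/-- The chain sum of a subgraph: up to a sign given by the number of components, it is the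
indicator of the relative interior. -/
theorem chainSum_closedSets [Nonempty B] {a : W ⊕ B → ℤ} (ha : weight a Finset.univ = 0)
    (G : Finset V.E) : chainSum a (V.closedSets G) =
      if InRelint a (V.closedSets G) then (-1) ^ (V.numComponents G - 1) else 0 :=
  chainSum_eq ha _ (isSetRing_closedSets G) _ (by
    rw [card_complemented_closedSets, Nat.sub_add_cancel (numComponents_pos G)])

end closed

end BipGraph

/-! ### Reachability and loops -/

namespace BipGraph

open SetRing

variable {W B : Type} {V : BipGraph W B}

/-- A step of the directed graph in which every edge of `G` leads from its white to its black
endpoint, and every edge of `Y`, except `e`, from its black to its white endpoint. -/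
def Step (G Y : Finset V.E) (e : V.E) (x y : W ⊕ B) : Prop :=
  (∃ g ∈ G, x = Sum.inl (V.white g) ∧ y = Sum.inr (V.black g)) ∨
    ∃ g ∈ Y, g ≠ e ∧ x = Sum.inr (V.black g) ∧ y = Sum.inl (V.white g)

/-- Reachability in the directed graph of `Step`. -/
def Reach (G Y : Finset V.E) (e : V.E) : W ⊕ B → W ⊕ B → Prop :=
  Relation.ReflTransGen (Step G Y e)

theorem Reach.mono {G G' Y Y' : Finset V.E} {e : V.E} (hG : G ⊆ G') (hY : Y ⊆ Y') {x y : W ⊕ B}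
    (h : Reach G Y e x y) : Reach G' Y' e x y :=
  Relation.ReflTransGen.mono (fun _ _ h => h.imp (fun ⟨g, hg, h⟩ => ⟨g, hG hg, h⟩)
    fun ⟨g, hg, h⟩ => ⟨g, hY hg, h⟩) x y h

theorem Reach.up {G Y : Finset V.E} {e : V.E} {x : W ⊕ B} {g : V.E} (hg : g ∈ G)
    (h : Reach G Y e x (Sum.inl (V.white g))) : Reach G Y e x (Sum.inr (V.black g)) :=
  h.tail (Or.inl ⟨g, hg, rfl, rfl⟩)

theorem Reach.down {G Y : Finset V.E} {e : V.E} {x : W ⊕ B} {g : V.E} (hg : g ∈ Y) (hge : g ≠ e)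
    (h : Reach G Y e x (Sum.inr (V.black g))) : Reach G Y e x (Sum.inl (V.white g)) :=
  h.tail (Or.inr ⟨g, hg, hge, rfl, rfl⟩)

/-- A walk `d 0, u 0, d 1, u 1, …, d n` in `G` that starts at the black vertex `s` and whose edges
`d i` differ from `e`. -/
structure IsWalk (G : Finset V.E) (e : V.E) (s : B) (n : ℕ) (d u : ℕ → V.E) : Prop where
  start : V.black (d 0) = s
  down_mem : ∀ i ≤ n, d i ∈ G ∧ d i ≠ e
  up_mem : ∀ i < n, u i ∈ G
  white_eq : ∀ i < n, V.white (d i) = V.white (u i)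
  black_eq : ∀ i < n, V.black (u i) = V.black (d (i + 1))

theorem exists_isWalk_of_reach {G : Finset V.E} {e : V.E} {s : B} {y : W ⊕ B}
    (h : Reach G G e (Sum.inr s) y) :
    (∀ w, y = Sum.inl w → ∃ n d u, IsWalk G e s n d u ∧ V.white (d n) = w) ∧
    (∀ b, y = Sum.inr b → b = s ∨ ∃ n d u, IsWalk G e s n d u ∧
      ∃ g ∈ G, V.white (d n) = V.white g ∧ V.black g = b) := by
  induction h with
  | refl => exact ⟨fun w h => by simp at h, fun b h => Or.inl (Sum.inr_injective h).symm⟩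
  | tail _ h ih =>
    rcases h with ⟨g, hg, rfl, rfl⟩ | ⟨g, hg, hge, rfl, rfl⟩
    · refine ⟨fun w h => by simp at h, fun b h => Or.inr ?_⟩
      obtain ⟨n, d, u, hw, hn⟩ := ih.1 _ rfl
      exact ⟨n, d, u, hw, g, hg, hn, Sum.inr_injective h⟩
    · refine ⟨fun w h => ?_, fun b h => by simp at h⟩
      obtain rfl := Sum.inl_injective h
      rcases ih.2 _ rfl with hs | ⟨n, d, u, hw, g', hg', h1, h2⟩
      · exact ⟨0, fun _ => g, fun _ => g,
          ⟨hs, fun _ _ => ⟨hg, hge⟩, by simp, by simp, by simp⟩, rfl⟩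
      · refine ⟨n + 1, fun k => if k ≤ n then d k else g, fun k => if k < n then u k else g',
          ⟨by simpa using hw.start, fun i hi => ?_, fun i hi => ?_, fun i hi => ?_, fun i hi => ?_⟩,
          by simp⟩
        · split_ifs with hin
          · exact hw.down_mem i hin
          · exact ⟨hg, hge⟩
        · split_ifs with hin
          · exact hw.up_mem i hin
          · exact hg'
        · have hin : i ≤ n := by omega
          simp only [hin, if_true]; split_ifs with hin'
          · exact hw.white_eq i hin'
          · obtain rfl : i = n := by omega
            exact h1
        · by_cases hin : i < n
          · simp only [hin, if_true, Nat.succ_le_of_lt hin]; exact hw.black_eq i hin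
          · obtain rfl : i = n := by omega
            simpa using h2

/-- A walk that visits a black vertex twice can be shortened. -/
theorem IsWalk.cut_black {G : Finset V.E} {e : V.E} {s : B} {n : ℕ} {d u : ℕ → V.E}
    (h : IsWalk G e s n d u) {i k : ℕ} (hk : i + k ≤ n) (hb : V.black (d i) = V.black (d (i + k))) :
    ∃ d' u', IsWalk G e s (n - k) d' u' ∧ d' (n - k) = d n := by
  refine ⟨fun m => if m < i then d m else d (m + k), fun m => if m < i then u m else u (m + k),
    ⟨?_, fun m hm => ?_, fun m hm => ?_, fun m hm => ?_, fun m hm => ?_⟩, ?_⟩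
  · split_ifs with h0
    · exact h.start
    · obtain rfl : i = 0 := by omega
      rw [← hb]; exact h.start
  · split_ifs with h0 <;> exact h.down_mem _ (by omega)
  · split_ifs with h0 <;> exact h.up_mem _ (by omega)
  · split_ifs with h0 <;> exact h.white_eq _ (by omega)
  · split_ifs with h0 h1 h1
    · exact h.black_eq _ (by omega)
    · obtain rfl : i = m + 1 := by omega
      rw [← hb]; exact h.black_eq _ (by omega)
    · omega
    · rw [h.black_eq _ (by omega)]; congr 2; omega
  · beta_reduce; rw [if_neg (by omega)]; congr 1; omega

/-- A walk that visits a white vertex twice can be shortened. -/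
theorem IsWalk.cut_white {G : Finset V.E} {e : V.E} {s : B} {n : ℕ} {d u : ℕ → V.E}
    (h : IsWalk G e s n d u) {i k : ℕ} (hk : i + k ≤ n) (hb : V.white (d i) = V.white (d (i + k))) :
    ∃ d' u', IsWalk G e s (n - k) d' u' ∧ V.white (d' (n - k)) = V.white (d n) := by
  refine ⟨fun m => if m ≤ i then d m else d (m + k), fun m => if m < i then u m else u (m + k),
    ⟨?_, fun m hm => ?_, fun m hm => ?_, fun m hm => ?_, fun m hm => ?_⟩, ?_⟩
  · simpa using h.start
  · split_ifs with h0 <;> exact h.down_mem _ (by omega)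
  · split_ifs with h0 <;> exact h.up_mem _ (by omega)
  · split_ifs with h0 h1 h1
    · exact h.white_eq _ (by omega)
    · obtain rfl : i = m := by omega
      rw [hb]; exact h.white_eq _ (by omega)
    · omega
    · exact h.white_eq _ (by omega)
  · split_ifs with h0 h1 h1
    · exact h.black_eq _ (by omega)
    · omega
    · omega
    · rw [h.black_eq _ (by omega)]; congr 2; omega
  · beta_reduce; split_ifs with h0
    · obtain rfl : i = n - k := by omega
      rw [hb]; congr 2; omega
    · congr 2; omega

/-- If the white endpoint of `e` can be reached from its black endpoint without `e`, then `e` is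
an edge of a loop: close up a walk of minimal length. -/
theorem exists_loop_of_reach {G : Finset V.E} {e : V.E} (he : e ∈ G)
    (h : Reach G G e (Sum.inr (V.black e)) (Sum.inl (V.white e))) :
    ∃ (n : ℕ) (L : V.OrientedLoop G n), L.up (Fin.last n) = e := by
  classical
  have hex : ∃ n d u, IsWalk G e (V.black e) n d u ∧ V.white (d n) = V.white e :=
    (exists_isWalk_of_reach h).1 _ rfl
  obtain ⟨d, u, hw, hn⟩ := Nat.find_spec hex
  have hmin := fun m => Nat.find_min hex (m := m)
  generalize Nat.find hex = n at *
  have hblack : ∀ i j, i < j → j ≤ n → V.black (d i) ≠ V.black (d j) := by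
    intro i j hij hj heq
    obtain ⟨k, rfl⟩ := Nat.exists_eq_add_of_lt hij
    obtain ⟨d', u', hw', hn'⟩ := hw.cut_black (i := i) (k := k + 1) (by omega) heq
    exact hmin _ (by omega) ⟨d', u', hw', by rw [hn', hn]⟩
  have hwhite : ∀ i j, i < j → j ≤ n → V.white (d i) ≠ V.white (d j) := by
    intro i j hij hj heq
    obtain ⟨k, rfl⟩ := Nat.exists_eq_add_of_lt hij
    obtain ⟨d', u', hw', hn'⟩ := hw.cut_white (i := i) (k := k + 1) (by omega) heq
    exact hmin _ (by omega) ⟨d', u', hw', by rw [hn', hn]⟩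
  have hwhite' : ∀ i j, i ≤ n → j ≤ n → V.white (d i) = V.white (d j) → i = j := by
    intro i j hi hj heq
    rcases lt_trichotomy i j with h | h | h
    · exact absurd heq (hwhite i j h hj)
    · exact h
    · exact absurd heq.symm (hwhite j i h hi)
  -- the walk, completed by `e`
  set u' : ℕ → V.E := fun k => if k < n then u k else e with hu'
  have hu_last : u' n = e := by simp [hu']
  have hu_white : ∀ i ≤ n, V.white (d i) = V.white (u' i) := by
    intro i hi
    rcases hi.lt_or_eq with h | rfl
    · simpa [hu', h] using hw.white_eq i h
    · rw [hu_last, hn]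
  refine ⟨n, ⟨fun i => d i, fun i => u' i, fun i => (hw.down_mem i (by omega)).1, fun i => ?_,
    fun i => hu_white i (by omega), fun i => ?_, fun i j hij => ?_, fun i j hij => ?_,
    fun i j hij => ?_⟩, by simpa using hu_last⟩
  · rw [hu']; beta_reduce; split_ifs with h
    · exact hw.up_mem _ h
    · exact he
  · induction i using Fin.lastCases with
    | last => rw [Fin.last_add_one, Fin.val_last, hu_last]; exact hw.start.symm
    | cast i =>
      rw [Fin.coeSucc_eq_succ, Fin.val_castSucc, Fin.val_succ]
      simp only [hu', i.is_lt, if_true]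
      exact hw.black_eq i i.is_lt
  · exact Fin.ext (hwhite' i j (by omega) (by omega) (congrArg V.white hij))
  · refine Fin.ext (hwhite' i j (by omega) (by omega) ?_)
    rw [hu_white i (by omega), hu_white j (by omega)]
    exact congrArg V.white hij
  · have : (i : ℕ) = j := by
      refine hwhite' i j (by omega) (by omega) ?_
      rw [hu_white j (by omega)]
      exact congrArg V.white hij
    rw [← this] at hij
    by_cases h : (i : ℕ) < n
    · rw [hu'] at hij
      simp only [h, if_true] at hij
      refine hblack i (i + 1) (by omega) (by omega) ?_
      rw [← hw.black_eq i h, hij]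
    · have h' : (i : ℕ) = n := by omega
      rw [h', hu_last] at hij
      exact (hw.down_mem n le_rfl).2 hij

/-- The vertices of a loop can be reached from the beginning of the loop, as long as the edges from
black to white are available. -/
theorem OrientedLoop.reach_black {G G' Y : Finset V.E} {n : ℕ} (L : V.OrientedLoop G n)
    (hup : ∀ i, L.up i ∈ G') (i : ℕ) (hi : i < n + 1)
    (hdown : ∀ j : Fin (n + 1), (j : ℕ) < i → L.down j ∈ Y) :
    Reach G' Y (L.up (Fin.last n)) (Sum.inr (V.black (L.up (Fin.last n))))
      (Sum.inr (V.black (L.down ⟨i, hi⟩))) := by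
  induction i with
  | zero =>
    have := L.black_eq (Fin.last n)
    rw [Fin.last_add_one] at this
    rw [this]
    exact Relation.ReflTransGen.refl
  | succ i ih =>
    have h1 := ih (by omega) (fun j hj => hdown j (by omega))
    have h2 := h1.down (hdown ⟨i, by omega⟩ (by simp)) (L.down_ne_up _ _)
    rw [L.white_eq] at h2
    have h3 := h2.up (hup _)
    rw [L.black_eq ⟨i, by omega⟩] at h3
    convert h3 using 4
    have : (⟨i, by omega⟩ : Fin (n + 1)) = Fin.castSucc ⟨i, by omega⟩ := rfl
    rw [this, Fin.coeSucc_eq_succ]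
    rfl

theorem OrientedLoop.reach_white {G G' Y : Finset V.E} {n : ℕ} (L : V.OrientedLoop G n)
    (hup : ∀ i, L.up i ∈ G') (hdown : ∀ j, L.down j ∈ Y) :
    Reach G' Y (L.up (Fin.last n)) (Sum.inr (V.black (L.up (Fin.last n))))
      (Sum.inl (V.white (L.up (Fin.last n)))) := by
  rw [← L.white_eq]
  exact (L.reach_black hup n (by omega) fun j _ => hdown j).down (hdown _) (L.down_ne_up _ _)

section reachSet

variable [Fintype W] [Fintype B]

open scoped Classical in
/-- The set of vertices that can be reached from `x`. -/
noncomputable def reachSet (G Y : Finset V.E) (e : V.E) (x : W ⊕ B) : Finset (W ⊕ B) :=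
  Finset.univ.filter (Reach G Y e x)

theorem mem_reachSet {G Y : Finset V.E} {e : V.E} {x y : W ⊕ B} :
    y ∈ reachSet G Y e x ↔ Reach G Y e x y := by
  simp [reachSet]

theorem self_mem_reachSet {G Y : Finset V.E} {e : V.E} {x : W ⊕ B} : x ∈ reachSet G Y e x :=
  mem_reachSet.2 Relation.ReflTransGen.refl

theorem reachSet_up {G Y : Finset V.E} {e : V.E} {x : W ⊕ B} {g : V.E} (hg : g ∈ G)
    (h : Sum.inl (V.white g) ∈ reachSet G Y e x) : Sum.inr (V.black g) ∈ reachSet G Y e x :=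
  mem_reachSet.2 ((mem_reachSet.1 h).up hg)

theorem reachSet_down {G Y : Finset V.E} {e : V.E} {x : W ⊕ B} {g : V.E} (hg : g ∈ Y) (hge : g ≠ e)
    (h : Sum.inr (V.black g) ∈ reachSet G Y e x) : Sum.inl (V.white g) ∈ reachSet G Y e x :=
  mem_reachSet.2 ((mem_reachSet.1 h).down hg hge)

end reachSet

end BipGraph

/-! ### Forests in the relative interior are `q`-forests -/

namespace BipGraph

open SetRing

variable {W B : Type} {V : BipGraph W B}

/-- The weight function which is one at white vertices and `1 - q b` at a black vertex `b`. -/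
def qWeight (q : B → ℕ) : W ⊕ B → ℤ := Sum.elim (fun _ => 1) fun b => -((q b - 1 : ℕ) : ℤ)

theorem weight_qWeight (q : B → ℕ) (I : Finset (W ⊕ B)) :
    weight (qWeight q) I = I.toLeft.card - ∑ b ∈ I.toRight, ((q b - 1 : ℕ) : ℤ) := by
  conv_lhs => rw [weight, ← Finset.toLeft_disjSum_toRight (u := I), Finset.sum_disjSum]
  simp [qWeight, sub_eq_add_neg]

section

variable [DecidableEq W] [DecidableEq B]

/-- The white neighbours of a black vertex. -/
def neighbors (F : Finset V.E) (b : B) : Finset W := (F.filter fun e => V.black e = b).image V.white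

theorem mem_neighbors {F : Finset V.E} {b : B} {w : W} :
    w ∈ neighbors F b ↔ ∃ e ∈ F, V.white e = w ∧ V.black e = b := by
  simp only [neighbors, Finset.mem_image, Finset.mem_filter, and_assoc,
    and_comm (a := V.white _ = w)]

theorem card_neighbors (F : Finset V.E) (b : B) :
    Nat.card {w : W // ∃ e ∈ F, V.white e = w ∧ V.black e = b} = (neighbors F b).card :=
  Nat.subtype_card _ fun _ => mem_neighbors

variable [Fintype W] [Fintype B] {q : B → ℕ} {F : Finset V.E}

theorem weight_qWeight_univ (hq : ∑ b, (q b - 1) = Fintype.card W) :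
    weight (qWeight q) (Finset.univ : Finset (W ⊕ B)) = 0 := by
  rw [weight, Fintype.sum_sum_type]
  simp [qWeight, ← hq]

/-- In a forest the part beyond an edge has weight at most `-1`, seen from its white endpoint `w`.
As `w` has weight one, no second edge can end in `w`. -/
theorem IsForest.eq_of_white_eq (hF : V.IsForest F) (hq : ∑ b, (q b - 1) = Fintype.card W)
    (hR : InRelint (qWeight q) (V.closedSets F)) {g₁ g₂ : V.E} (h₁ : g₁ ∈ F) (h₂ : g₂ ∈ F)
    (hw : V.white g₁ = V.white g₂) : g₁ = g₂ := by
  by_contra hne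
  set T := reachSet F F g₁ (Sum.inr (V.black g₁))
  have hwT : Sum.inl (V.white g₁) ∉ T := fun h => by
    obtain ⟨n, L, -⟩ := exists_loop_of_reach h₁ (mem_reachSet.1 h)
    exact (hF n).false L
  have hTc : Tᶜ ∈ V.closedSets F := mem_closedSets.2 fun e he h => by
    rw [Finset.mem_compl] at *
    exact fun h' => h (reachSet_up he h')
  have hTneg : weight (qWeight q) T < 0 := by
    have h := hR _ hTc
    have h0 : weight (qWeight q) Tᶜ ≠ 0 := fun h0 => by
      have := h.2 h0
      rw [compl_compl] at this
      exact hwT (mem_closedSets.1 this g₁ h₁ self_mem_reachSet)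
    have := weight_add_compl (qWeight q) T
    rw [weight_qWeight_univ hq] at this
    have := h.1
    omega
  have hT' : insert (Sum.inl (V.white g₁)) T ∈ V.closedSets F := mem_closedSets.2 fun e he h => by
    rw [Finset.mem_insert] at *
    by_cases heg : e = g₁
    · exact Or.inl (by rw [heg])
    · exact Or.inr (reachSet_down he heg (h.resolve_left (by simp)))
  have hwt : weight (qWeight q) (insert (Sum.inl (V.white g₁)) T) = 1 + weight (qWeight q) T := by
    rw [weight, Finset.sum_insert hwT]; rfl
  have h := hR _ hT'
  have hc := mem_closedSets.1 (h.2 (by have := h.1; omega)) g₂ h₂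
  have hb : Sum.inr (V.black g₂) ∈ T := by
    by_contra hb
    have := hc (by simpa using hb)
    rw [← hw] at this
    simp at this
  have := reachSet_down h₂ (Ne.symm hne) hb
  rw [← hw] at this
  exact hwT this

theorem exists_edge_of_inRelint (hq : ∑ b, (q b - 1) = Fintype.card W)
    (hR : InRelint (qWeight q) (V.closedSets F)) (w : W) : ∃ e ∈ F, V.white e = w := by
  by_contra! hcon
  have hc : ({Sum.inl w}ᶜ : Finset (W ⊕ B)) ∈ V.closedSets F := mem_closedSets.2 fun e he _ => by
    simpa using hcon e he
  have h1 := (hR _ hc).1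
  have h2 := weight_add_compl (qWeight q) ({Sum.inl w} : Finset (W ⊕ B))
  rw [weight_qWeight_univ hq] at h2
  have h3 : weight (qWeight q) ({Sum.inl w} : Finset (W ⊕ B)) = 1 := by
    rw [weight, Finset.sum_singleton]; rfl
  omega

/-- Among the forests, the relative interior condition singles out the `q`-forests. -/
theorem IsForest.isQForest_of_inRelint (hF : V.IsForest F)
    (hq : ∑ b, (q b - 1) = Fintype.card W) (hR : InRelint (qWeight q) (V.closedSets F)) :
    V.IsQForest q F := by
  -- the star of a black vertex is a component
  have hstar : ∀ b : B, (neighbors F b).disjSum {b} ∈ complemented (V.closedSets F) := fun b => by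
    rw [mem_complemented_closedSets]
    intro e he
    simp only [Finset.inr_mem_disjSum, Finset.inl_mem_disjSum, Finset.mem_singleton, mem_neighbors]
    refine ⟨fun h => ⟨e, he, rfl, h⟩, fun ⟨e', he', hw, hb⟩ => ?_⟩
    rw [← hF.eq_of_white_eq hq hR he' he hw, hb]
  refine ⟨hF, fun b b' h => ?_, fun b => ?_⟩
  · have := (reachable_iff_of_mem_complemented (hstar b) h).1 (by simp)
    rw [Finset.inr_mem_disjSum, Finset.mem_singleton] at this
    exact this.symm
  · have h := hR.weight_eq_zero (weight_qWeight_univ hq) (hstar b)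
    rw [weight_qWeight, Finset.toLeft_disjSum, Finset.toRight_disjSum, Finset.sum_singleton] at h
    rw [card_neighbors]
    omega

theorem IsQForest.disjoint_neighbors (hF : V.IsQForest q F) {b b' : B} {w : W}
    (h : w ∈ neighbors F b) (h' : w ∈ neighbors F b') : b = b' := by
  obtain ⟨e, he, rfl, rfl⟩ := mem_neighbors.1 h
  obtain ⟨e', he', hw, rfl⟩ := mem_neighbors.1 h'
  have h1 := (toSimpleGraph_adj he).reachable.symm
  have h2 := (toSimpleGraph_adj he').reachable
  rw [hw] at h2
  exact hF.2.1 _ _ (h1.trans h2)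

theorem IsQForest.inRelint (hF : V.IsQForest q F) : InRelint (qWeight q) (V.closedSets F) := by
  intro I hI
  have hsub : I.toRight.biUnion (neighbors F) ⊆ I.toLeft := by
    intro w hw
    obtain ⟨b, hb, hw⟩ := Finset.mem_biUnion.1 hw
    obtain ⟨e, he, rfl, rfl⟩ := mem_neighbors.1 hw
    rw [Finset.mem_toRight] at hb
    exact Finset.mem_toLeft.2 (mem_closedSets.1 hI e he hb)
  have hcard : (I.toRight.biUnion (neighbors F)).card = ∑ b ∈ I.toRight, (q b - 1) := by
    rw [Finset.card_biUnion]
    · exact Finset.sum_congr rfl fun b _ => by rw [← card_neighbors, hF.2.2]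
    · intro b _ b' _ hne
      exact Finset.disjoint_left.2 fun w h h' => hne (hF.disjoint_neighbors h h')
  have hle := Finset.card_le_card hsub
  rw [weight_qWeight, ← Nat.cast_sum, ← hcard]
  refine ⟨by omega, fun h0 => ?_⟩
  have heq := Finset.eq_of_subset_of_card_le hsub (by omega)
  refine mem_closedSets.2 fun e he hb => ?_
  rw [Finset.mem_compl] at *
  intro hw
  rw [← Finset.mem_toLeft, ← heq, Finset.mem_biUnion] at hw
  obtain ⟨b, hb', hw⟩ := hw
  rw [hF.disjoint_neighbors hw (mem_neighbors.2 ⟨e, he, rfl, rfl⟩), Finset.mem_toRight] at hb'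
  exact hb hb'

/-- The components of a `q`-forest correspond to the black vertices. -/
theorem IsQForest.numComponents_eq (hF : V.IsQForest q F)
    (hq : ∑ b, (q b - 1) = Fintype.card W) : V.numComponents F = Nat.card B := by
  refine (Nat.card_eq_of_bijective
    (fun b => (V.toSimpleGraph F).connectedComponentMk (Sum.inr b))
    ⟨fun b b' h => ?_, fun c => ?_⟩).symm
  · exact hF.2.1 _ _ (SimpleGraph.ConnectedComponent.exact h)
  · induction c using SimpleGraph.ConnectedComponent.ind with
    | h x =>
      rcases x with w | b
      · obtain ⟨e, he, rfl⟩ := exists_edge_of_inRelint hq hF.inRelint w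
        exact ⟨V.black e,
          SimpleGraph.ConnectedComponent.sound (toSimpleGraph_adj he).reachable.symm⟩
      · exact ⟨b, rfl⟩

open scoped Classical in
/-- The sum of the coefficients of the `q`-forests is determined by the graph from which the
iteration starts. -/
theorem IsDecomposition.qForestSum_eq [Nonempty B] (hq : ∑ b, (q b - 1) = Fintype.card W)
    {G : Finset V.E} {S : Finset V.E →₀ ℤ} (h : V.IsDecomposition G S) :
    (-1) ^ (Nat.card B - 1) * V.qForestSum q S =
      if InRelint (qWeight q) (V.closedSets G) then (-1) ^ (V.numComponents G - 1) else 0 := by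
  have ha := weight_qWeight_univ hq
  rw [← chainSum_closedSets ha, ← h.sum_eq fun G n L => isInvariantAt_chainSum (qWeight q) L,
    qForestSum, Finsupp.mul_sum]
  refine Finsupp.sum_congr fun F hF => ?_
  have hforest := h.isForest (Finsupp.mem_support_iff.1 hF)
  rw [chainSum_closedSets ha]
  by_cases hR : InRelint (qWeight q) (V.closedSets F)
  · have hqF := hforest.isQForest_of_inRelint hq hR
    rw [if_pos hqF, if_pos hR, hqF.numComponents_eq hq, mul_comm]
  · rw [if_neg fun hqF => hR (IsQForest.inRelint hqF), if_neg hR, mul_zero, mul_zero]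

end

end BipGraph

/-! ### Expansions along loops through a fixed edge -/

namespace BipGraph

open SetRing

variable {W B : Type} {V : BipGraph W B}

/-- Deleting arcs does not affect reachability from `x` if the endpoint of every deleted arc can be
reached without it. -/
theorem Reach.of_deleted {G G' Y Y' : Finset V.E} {e : V.E} {x y : W ⊕ B}
    (hup : ∀ g ∈ G, g ∈ G' ∨ Reach G' Y' e x (Sum.inr (V.black g)))
    (hdown : ∀ g ∈ Y, g ≠ e →
      g ∈ Y' ∨ Reach G' Y' e (Sum.inr (V.black g)) (Sum.inl (V.white g)))
    (h : Reach G Y e x y) : Reach G' Y' e x y := by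
  induction h with
  | refl => exact Relation.ReflTransGen.refl
  | tail _ h ih =>
    rcases h with ⟨g, hg, rfl, rfl⟩ | ⟨g, hg, hge, rfl, rfl⟩
    · exact (hup g hg).elim ih.up id
    · exact (hdown g hg hge).elim (ih.down · hge) ih.trans

open scoped Classical in
/-- The indicator of the pairs `Y ⊆ G` for which the white endpoint of `e` cannot be reached from
its black endpoint. -/
noncomputable def unreachIndicator (e : V.E) (Y G : Finset V.E) : ℤ :=
  if Y ⊆ G ∧ ¬ Reach G Y e (Sum.inr (V.black e)) (Sum.inl (V.white e)) then 1 else 0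

/-- The indicator does not notice whether the first edge of the loop from black to white that is
not in `Y` is removed: its black endpoint remains accessible along the loop. -/
theorem isInvariantAt_unreachIndicator (Y : Finset V.E) {G : Finset V.E} {n : ℕ}
    (L : V.OrientedLoop G n) :
    V.IsInvariantAt (unreachIndicator (L.up (Fin.last n)) Y) L := by
  unfold IsInvariantAt
  by_cases hY : ∀ j, L.down j ∈ Y
  · refine Finset.sum_eq_zero fun A hA => ?_
    rw [unreachIndicator, if_neg, mul_zero]
    exact fun h => h.2 (L.reach_white (fun i => L.up_mem_sdiff i (Finset.mem_powerset.1 hA)) hY)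
  · push Not at hY
    obtain ⟨i, hi, hmin⟩ : ∃ i, L.down i ∉ Y ∧ ∀ j < i, L.down j ∈ Y := by
      obtain ⟨i, hi, hmin⟩ := WellFounded.has_min (wellFounded_lt (α := Fin (n + 1)))
        {i | L.down i ∉ Y} hY
      exact ⟨i, hi, fun j hj => by_contra fun h => hmin j h hj⟩
    refine sum_powerset_neg_one_pow_eq_zero_of_insert (L.down_mem_blackToWhite i) _
      fun A hA hiA => ?_
    have hsub : Y ⊆ G \ insert (L.down i) A ↔ Y ⊆ G \ A := by
      refine ⟨fun h => h.trans (Finset.sdiff_subset_sdiff le_rfl (Finset.subset_insert _ _)),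
        fun h x hx => ?_⟩
      have := Finset.mem_sdiff.1 (h hx)
      refine Finset.mem_sdiff.2 ⟨this.1, fun h' => ?_⟩
      rcases Finset.mem_insert.1 h' with rfl | h'
      · exact hi hx
      · exact this.2 h'
    have hreach : Reach (G \ insert (L.down i) A) Y (L.up (Fin.last n))
          (Sum.inr (V.black (L.up (Fin.last n)))) (Sum.inl (V.white (L.up (Fin.last n)))) ↔
        Reach (G \ A) Y (L.up (Fin.last n))
          (Sum.inr (V.black (L.up (Fin.last n)))) (Sum.inl (V.white (L.up (Fin.last n)))) := by
      refine ⟨Reach.mono (Finset.sdiff_subset_sdiff le_rfl (Finset.subset_insert _ _)) le_rfl,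
        Reach.of_deleted (fun g hg => ?_) fun g hg _ => Or.inl hg⟩
      by_cases hgi : g = L.down i
      · subst hgi
        refine Or.inr (L.reach_black (fun j => L.up_mem_sdiff j ?_) i i.is_lt fun j hj => hmin j hj)
        exact Finset.insert_subset (L.down_mem_blackToWhite i) hA
      · exact Or.inl (by simp_all)
    unfold unreachIndicator
    congr 1
    rw [hsub, hreach]

/-- The result of local transformations along loops through `e`, where `e` is always oriented from
its white to its black endpoint (so that it is never removed), until no such loop is left. -/
inductive IsPivotExpansion (e : V.E) : Finset V.E → (Finset V.E →₀ ℤ) → Prop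
  | leaf (G : Finset V.E) (hG : ∀ (n : ℕ) (L : V.OrientedLoop G n), L.up (Fin.last n) ≠ e) :
      IsPivotExpansion e G (Finsupp.single G 1)
  | transform (G : Finset V.E) (n : ℕ) (L : V.OrientedLoop G n) (hL : L.up (Fin.last n) = e)
      (S : Finset V.E → (Finset V.E →₀ ℤ))
      (hS : ∀ A ⊆ L.blackToWhite, A.Nonempty → IsPivotExpansion e (G \ A) (S A)) :
      IsPivotExpansion e G
        (∑ A ∈ L.blackToWhite.powerset.erase ∅, (-1 : ℤ) ^ (A.card - 1) • S A)

theorem OrientedLoop.sdiff_ssubset {G : Finset V.E} {n : ℕ} (L : V.OrientedLoop G n)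
    {A : Finset V.E} (hA : A ⊆ L.blackToWhite) (hne : A.Nonempty) : G \ A ⊂ G :=
  Finset.sdiff_ssubset (hA.trans L.blackToWhite_subset) hne

theorem exists_isPivotExpansion (e : V.E) (G : Finset V.E) : ∃ X, IsPivotExpansion e G X := by
  induction G using Finset.strongInduction with
  | H G ih =>
  by_cases hG : ∀ (n : ℕ) (L : V.OrientedLoop G n), L.up (Fin.last n) ≠ e
  · exact ⟨_, .leaf G hG⟩
  · push Not at hG
    obtain ⟨n, L, hL⟩ := hG
    have : ∀ A, ∃ X, A ⊆ L.blackToWhite → A.Nonempty → IsPivotExpansion e (G \ A) X := fun A => by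
      by_cases h : A ⊆ L.blackToWhite ∧ A.Nonempty
      · obtain ⟨X, hX⟩ := ih _ (L.sdiff_ssubset h.1 h.2)
        exact ⟨X, fun _ _ => hX⟩
      · exact ⟨0, fun h1 h2 => absurd ⟨h1, h2⟩ h⟩
    choose S hS using this
    exact ⟨_, .transform G n L hL S hS⟩

namespace IsPivotExpansion

variable {e : V.E} {G : Finset V.E} {X : Finset V.E →₀ ℤ}

theorem sum_eq {Φ : Finset V.E → ℤ} (hΦ : ∀ (G : Finset V.E) (n : ℕ) (L : V.OrientedLoop G n),
      L.up (Fin.last n) = e → V.IsInvariantAt Φ L) (h : IsPivotExpansion e G X) :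
    X.sum (fun F x => x * Φ F) = Φ G := by
  induction h with
  | leaf G hG => simp
  | transform G n L hL S hS ih =>
    rw [sum_smul_finset, (hΦ G n L hL).eq_sum]
    refine Finset.sum_congr rfl fun A hA => ?_
    rw [ih A (Finset.mem_powerset.1 (Finset.mem_erase.1 hA).2)
      (Finset.nonempty_iff_ne_empty.2 (Finset.mem_erase.1 hA).1)]

theorem of_ne_zero (h : IsPivotExpansion e G X) {H : Finset V.E} (hH : X H ≠ 0) :
    H ⊆ G ∧ (e ∈ G → e ∈ H) ∧ ∀ (n : ℕ) (L : V.OrientedLoop H n), L.up (Fin.last n) ≠ e := by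
  induction h with
  | leaf G hG =>
    rw [Finsupp.single_apply] at hH
    split_ifs at hH with h
    · subst h; exact ⟨le_rfl, id, hG⟩
    · exact absurd rfl hH
  | transform G n L hL S hS ih =>
    rw [Finsupp.finsetSum_apply] at hH
    obtain ⟨A, hA, h⟩ := Finset.exists_ne_zero_of_sum_ne_zero hH
    rw [Finsupp.smul_apply, smul_eq_mul] at h
    have hA1 := Finset.mem_powerset.1 (Finset.mem_erase.1 hA).2
    obtain ⟨h1, h2, h3⟩ := ih A hA1
      (Finset.nonempty_iff_ne_empty.2 (Finset.mem_erase.1 hA).1) (right_ne_zero_of_mul h)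
    exact ⟨h1.trans Finset.sdiff_subset, fun _ => h2 (hL ▸ L.up_mem_sdiff _ hA1), h3⟩

/-- An expansion can be completed to a decomposition by decomposing its summands. -/
theorem isDecomposition (h : IsPivotExpansion e G X) (S : Finset V.E → (Finset V.E →₀ ℤ))
    (hS : ∀ H ⊆ G, (∀ (n : ℕ) (L : V.OrientedLoop H n), L.up (Fin.last n) ≠ e) →
      V.IsDecomposition H (S H)) :
    V.IsDecomposition G (X.sum fun H x => x • S H) := by
  induction h with
  | leaf G hG => simpa using hS G le_rfl hG
  | transform G n L hL T hT ih =>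
    have : (∑ A ∈ L.blackToWhite.powerset.erase ∅, (-1 : ℤ) ^ (A.card - 1) • T A).sum
        (fun H x => x • S H) = ∑ A ∈ L.blackToWhite.powerset.erase ∅,
          (-1 : ℤ) ^ (A.card - 1) • (T A).sum fun H x => x • S H := by
      rw [← Finsupp.sum_finsetSum_index (by simp) (by intros; exact add_smul _ _ _)]
      refine Finset.sum_congr rfl fun A _ => ?_
      rw [Finsupp.sum_smul_index (by simp), Finsupp.smul_sum]
      exact Finsupp.sum_congr fun _ _ => mul_smul _ _ _
    rw [this]
    exact .transform G n L _ fun A hA hne => ih A hA hne fun H hH =>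
      hS H (hH.trans Finset.sdiff_subset)

/-- The moments of an expansion do not depend on the choice of the loops. -/
theorem sum_superset_eq (h : IsPivotExpansion e G X) (he : e ∈ G) (Y : Finset V.E) :
    (∑ H, if Y ⊆ H then X H else 0) = unreachIndicator e Y G := by
  rw [← h.sum_eq (Φ := unreachIndicator e Y) fun G n L hL => by
      subst hL; exact isInvariantAt_unreachIndicator Y L,
    Finsupp.sum_fintype _ _ (by simp)]
  refine Finset.sum_congr rfl fun H _ => ?_
  by_cases hH : X H = 0
  · simp [hH]
  obtain ⟨-, heH, hloop⟩ := h.of_ne_zero hH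
  unfold unreachIndicator
  by_cases hY : Y ⊆ H
  · rw [if_pos hY, if_pos, mul_one]
    refine ⟨hY, fun hreach => ?_⟩
    obtain ⟨n, L, hL⟩ := exists_loop_of_reach (heH he) (hreach.mono le_rfl hY)
    exact hloop n L hL
  · rw [if_neg hY, if_neg fun h => hY h.1, mul_zero]

end IsPivotExpansion

/-- A function on a family of sets vanishes if its sums over the supersets of each member of the
family vanish. -/
theorem eq_zero_of_sum_superset_eq_zero {ι : Type*} [Fintype ι] [DecidableEq ι] (f : Finset ι → ℤ)
    (P : Finset ι → Prop) [DecidablePred P] (H : Finset ι)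
    (h : ∀ Y, H ⊆ Y → P Y → (∑ Z, if Y ⊆ Z ∧ P Z then f Z else 0) = 0) (hP : P H) : f H = 0 := by
  suffices ∀ Y, H ⊆ Y → P Y → f Y = 0 from this H le_rfl hP
  intro Y
  induction Y using WellFoundedGT.induction with
  | ind Y ih =>
  intro hHY hPY
  rw [← h Y hHY hPY, Finset.sum_eq_single Y]
  · rw [if_pos ⟨le_rfl, hPY⟩]
  · intro Z _ hZY
    split_ifs with hZ
    · exact ih Z (lt_of_le_of_ne hZ.1 (Ne.symm hZY)) (hHY.trans hZ.1) hZ.2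
    · rfl
  · exact fun h => absurd (Finset.mem_univ _) h

/-- The properties of the subgraphs that occur in an expansion with pivot `e`.  Geometrically, `H`
is spanned by `e` and a face of the cone of `G` that does not contain `e`. -/
structure IsPivotFace (G : Finset V.E) (e : V.E) (H : Finset V.E) : Prop where
  subset : H ⊆ G
  mem : e ∈ H
  not_reach : ¬ Reach G H e (Sum.inr (V.black e)) (Sum.inl (V.white e))
  not_reach_of_notMem : ∀ g ∈ G, g ∉ H → ¬ Reach G H e (Sum.inr (V.black g)) (Sum.inl (V.white g))

theorem IsPivotExpansion.isPivotFace {e : V.E} {G : Finset V.E} {X : Finset V.E →₀ ℤ}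
    (h : IsPivotExpansion e G X) (he : e ∈ G) {H : Finset V.E} (hH : X H ≠ 0) :
    IsPivotFace G e H := by
  obtain ⟨h1, h2, -⟩ := h.of_ne_zero hH
  refine ⟨h1, h2 he, fun hreach => hH ?_, fun g hg hgH hreach => hH ?_⟩
  · refine eq_zero_of_sum_superset_eq_zero X (fun _ => True) H (fun Y hY _ => ?_) trivial
    simp only [and_true]
    rw [h.sum_superset_eq he, unreachIndicator, if_neg]
    exact fun h => h.2 (hreach.mono le_rfl hY)
  · refine eq_zero_of_sum_superset_eq_zero X (fun Y => g ∉ Y) H (fun Y hY hgY => ?_) hgH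
    have hsplit : ∀ Z, (if Y ⊆ Z ∧ g ∉ Z then X Z else 0) =
        (if Y ⊆ Z then X Z else 0) - if insert g Y ⊆ Z then X Z else 0 := by
      intro Z
      by_cases h1 : Y ⊆ Z <;> by_cases h2 : g ∈ Z <;> simp [Finset.insert_subset_iff, h1, h2]
    simp only [hsplit]
    rw [Finset.sum_sub_distrib, h.sum_superset_eq he, h.sum_superset_eq he, sub_eq_zero]
    have hr : Reach G (insert g Y) e (Sum.inr (V.black e)) (Sum.inl (V.white e)) ↔
        Reach G Y e (Sum.inr (V.black e)) (Sum.inl (V.white e)) := by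
      refine ⟨Reach.of_deleted (fun _ => Or.inl) fun g' hg' _ => ?_,
        Reach.mono le_rfl (Finset.subset_insert _ _)⟩
      rcases Finset.mem_insert.1 hg' with rfl | hg'
      · exact Or.inr (hreach.mono le_rfl hY)
      · exact Or.inl hg'
    unfold unreachIndicator
    congr 1
    rw [hr, Finset.insert_subset_iff, and_iff_right hg]

end BipGraph

/-! ### Signs of the coefficients -/

namespace BipGraph

open SetRing

variable {W B : Type} {V : BipGraph W B} [Fintype W] [Fintype B] [DecidableEq W] [DecidableEq B]

/-- The sum over the edges in `H` of the difference of the white and the black endpoint. -/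
def edgeWeight (H : Finset V.E) (v : W ⊕ B) : ℤ :=
  ∑ g ∈ H, ((if Sum.inl (V.white g) = v then 1 else 0) - if Sum.inr (V.black g) = v then 1 else 0)

theorem weight_edgeWeight (H : Finset V.E) (I : Finset (W ⊕ B)) :
    weight (edgeWeight H) I = ∑ g ∈ H, ((if Sum.inl (V.white g) ∈ I then 1 else 0) -
      if Sum.inr (V.black g) ∈ I then 1 else 0 : ℤ) := by
  unfold weight edgeWeight
  rw [Finset.sum_comm]
  refine Finset.sum_congr rfl fun g _ => ?_
  rw [Finset.sum_sub_distrib, Finset.sum_ite_eq, Finset.sum_ite_eq]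

theorem weight_edgeWeight_univ (H : Finset V.E) :
    weight (edgeWeight H) Finset.univ = 0 := by
  simp [weight_edgeWeight]

/-- The edges of `H` that lead from a black vertex in `X` to a white vertex outside of `X`. -/
def leaving (H : Finset V.E) (X : Finset (W ⊕ B)) : Finset V.E :=
  H.filter fun g => Sum.inr (V.black g) ∈ X ∧ Sum.inl (V.white g) ∉ X

theorem mem_leaving {H : Finset V.E} {X : Finset (W ⊕ B)} {g : V.E} :
    g ∈ leaving H X ↔ g ∈ H ∧ Sum.inr (V.black g) ∈ X ∧ Sum.inl (V.white g) ∉ X :=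
  Finset.mem_filter

/-- A set is closed for `G` in the opposite direction if it contains, with a white vertex, all its
black neighbours. -/
def IsUpClosed (G : Finset V.E) (X : Finset (W ⊕ B)) : Prop :=
  ∀ g ∈ G, Sum.inl (V.white g) ∈ X → Sum.inr (V.black g) ∈ X

theorem IsUpClosed.compl_mem {G H : Finset V.E} (hH : H ⊆ G) {X : Finset (W ⊕ B)}
    (hX : IsUpClosed G X) : Xᶜ ∈ V.closedSets H := mem_closedSets.2 fun g hg h => by
  rw [Finset.mem_compl] at *
  exact fun h' => h (hX g (hH hg) h')

theorem IsUpClosed.weight_eq {G H : Finset V.E} (hH : H ⊆ G) {X : Finset (W ⊕ B)}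
    (hX : IsUpClosed G X) : weight (edgeWeight H) X = -((leaving H X).card : ℤ) := by
  rw [weight_edgeWeight, leaving, Finset.card_filter, Nat.cast_sum, ← Finset.sum_neg_distrib]
  refine Finset.sum_congr rfl fun g hg => ?_
  have := hX g (hH hg)
  by_cases h1 : Sum.inl (V.white g) ∈ X
  · simp [h1, this h1]
  · by_cases h2 : Sum.inr (V.black g) ∈ X <;> simp [h1, h2]

theorem inRelint_edgeWeight (H : Finset V.E) : InRelint (edgeWeight H) (V.closedSets H) := by
  intro I hI
  have hI' := mem_closedSets.1 hI
  have hnonneg : ∀ g ∈ H, 0 ≤ ((if Sum.inl (V.white g) ∈ I then 1 else 0) -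
      if Sum.inr (V.black g) ∈ I then 1 else 0 : ℤ) := fun g hg => by
    have := hI' g hg
    split_ifs <;> simp_all
  rw [weight_edgeWeight]
  refine ⟨Finset.sum_nonneg hnonneg, fun h0 => mem_closedSets.2 fun g hg hb => ?_⟩
  have := (Finset.sum_eq_zero_iff_of_nonneg hnonneg).1 h0 g hg
  rw [Finset.mem_compl] at *
  intro hw
  simp [hb, hw] at this

theorem isUpClosed_reachSet (G Y : Finset V.E) (e : V.E) (x : W ⊕ B) :
    IsUpClosed G (reachSet G Y e x) := fun _ hg h => reachSet_up hg h

/-- Two sets that are closed in the opposite direction and separate the endpoints of `e` are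
compared by means of closed sets. -/
theorem IsUpClosed.exchange {G H : Finset V.E} {e : V.E} (hH : H ⊆ G) {X X₀ : Finset (W ⊕ B)}
    (hX₀ : IsUpClosed G X₀)
    (hleave : ∀ g ∈ H, g ≠ e → Sum.inr (V.black g) ∈ X → Sum.inl (V.white g) ∈ X)
    (hb : Sum.inr (V.black e) ∈ X₀) (hw : Sum.inl (V.white e) ∉ X₀) :
    (X₀ \ X)ᶜ ∈ V.closedSets H ∧ X \ X₀ ∈ V.closedSets H ∧ ∀ a : W ⊕ B → ℤ,
      weight a X + weight a (X₀ \ X) = weight a X₀ + weight a (X \ X₀) := by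
  refine ⟨mem_closedSets.2 fun g hg h => ?_, mem_closedSets.2 fun g hg h => ?_, fun a => ?_⟩
  · simp only [Finset.mem_compl, Finset.mem_sdiff, not_and, not_not] at h ⊢
    intro hw₀
    refine hleave g hg ?_ (h (hX₀ g (hH hg) hw₀))
    rintro rfl
    exact hw hw₀
  · simp only [Finset.mem_sdiff] at h ⊢
    refine ⟨hleave g hg ?_ h.1, fun h' => h.2 (hX₀ g (hH hg) h')⟩
    rintro rfl
    exact h.2 hb
  · have h1 := Finset.sum_inter_add_sum_sdiff X X₀ a
    have h2 := Finset.sum_inter_add_sum_sdiff X₀ X a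
    rw [Finset.inter_comm] at h2
    unfold weight
    omega

theorem leaving_reachSet_subset {G H : Finset V.E} {e : V.E} {x : W ⊕ B} :
    leaving H (reachSet G H e x) ⊆ {e} := by
  intro g hg
  obtain ⟨hg, hb, hw⟩ := mem_leaving.1 hg
  rw [Finset.mem_singleton]
  by_contra hne
  exact hw (reachSet_down hg hne hb)

/-- The cones spanned by two pivot faces have disjoint relative interiors. -/
theorem IsPivotFace.eq_of_inRelint {G : Finset V.E} {e : V.E} {H H₀ : Finset V.E}
    (hH : IsPivotFace G e H) (hH₀ : IsPivotFace G e H₀)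
    (hR : InRelint (edgeWeight H₀) (V.closedSets H)) : H = H₀ := by
  have hweight : ∀ X, weight (edgeWeight H₀) X + weight (edgeWeight H₀) Xᶜ = 0 := fun X => by
    rw [weight_add_compl, weight_edgeWeight_univ]
  have hge : ∀ x, -1 ≤ weight (edgeWeight H₀) (reachSet G H₀ e x) := fun x => by
    rw [(isUpClosed_reachSet G H₀ e x).weight_eq hH₀.subset]
    have := Finset.card_le_card (leaving_reachSet_subset (G := G) (H := H₀) (e := e) (x := x))
    rw [Finset.card_singleton] at this
    omega
  have hlt : ∀ X, IsUpClosed G X → ∀ g ∈ leaving H₀ X, weight (edgeWeight H₀) X ≤ -1 :=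
    fun X hX g hg => by
      rw [hX.weight_eq hH₀.subset]
      have := Finset.card_pos.2 ⟨g, hg⟩
      omega
  have hout : ∀ {Y}, IsPivotFace G e Y →
      Sum.inl (V.white e) ∉ reachSet G Y e (Sum.inr (V.black e)) := fun hY h =>
    hY.not_reach (mem_reachSet.1 h)
  refine Finset.Subset.antisymm (fun g hg => ?_) fun g hg => ?_
  · by_contra hgH
    set X := reachSet G H₀ e (Sum.inr (V.black g))
    have hX : IsUpClosed G X := isUpClosed_reachSet _ _ _ _
    have hbX : Sum.inr (V.black g) ∈ X := self_mem_reachSet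
    have hwX : Sum.inl (V.white g) ∉ X := fun h =>
      hH₀.not_reach_of_notMem g (hH.subset hg) hgH (mem_reachSet.1 h)
    have hneg : weight (edgeWeight H₀) X < 0 := by
      have h := hR _ (hX.compl_mem hH.subset)
      have h0 : weight (edgeWeight H₀) Xᶜ ≠ 0 := fun h0 => by
        have := h.2 h0
        rw [compl_compl] at this
        exact hwX (mem_closedSets.1 this g hg hbX)
      have := hweight X
      have := h.1
      omega
    have heX : e ∈ leaving H₀ X := by
      rw [hX.weight_eq hH₀.subset] at hneg
      obtain ⟨e', he'⟩ := Finset.card_pos.1 (show 0 < (leaving H₀ X).card by omega)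
      have := leaving_reachSet_subset he'
      rw [Finset.mem_singleton] at this
      exact this ▸ he'
    obtain ⟨-, hb, hw⟩ := mem_leaving.1 heX
    set X₁ := reachSet G H e (Sum.inr (V.black e))
    have hX₁ : IsUpClosed G X₁ := isUpClosed_reachSet _ _ _ _
    obtain ⟨h1, h2, h3⟩ := hX.exchange hH.subset (X := X₁)
      (fun g hg hne h => reachSet_down hg hne h) hb hw
    have h4 := hlt X₁ hX₁ e (mem_leaving.2 ⟨hH₀.mem, self_mem_reachSet, hout hH⟩)
    have h5 : -1 ≤ weight (edgeWeight H₀) X := hge _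
    have h6 := hR _ h1
    have h7 := hR _ h2
    have h8 := hweight (X \ X₁)
    have h9 := h3 (edgeWeight H₀)
    have h10 := h6.1
    have h11 := h7.1
    -- `X \ X₁` and `X₁ \ X` are unions of components of `H`, but `g` leaves one of them
    have h12 := h6.2 (by omega)
    have h13 := h7.2 (by omega)
    rw [compl_compl] at h12
    by_cases hbX₁ : Sum.inr (V.black g) ∈ X₁
    · have hne : g ≠ e := by rintro rfl; exact hgH hH₀.mem
      have hwX₁ := reachSet_down hg hne hbX₁
      have := mem_closedSets.1 h13 g hg (by simp [hbX])
      simp only [Finset.mem_compl, Finset.mem_sdiff] at this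
      exact this ⟨hwX₁, hwX⟩
    · have := mem_closedSets.1 h12 g hg (by simp [hbX, hbX₁])
      exact hwX (Finset.mem_sdiff.1 this).1
  · by_contra hgH
    set X := reachSet G H e (Sum.inr (V.black g))
    have hX : IsUpClosed G X := isUpClosed_reachSet _ _ _ _
    have hgX : g ∈ leaving H₀ X := mem_leaving.2 ⟨hg, self_mem_reachSet, fun h =>
      hH.not_reach_of_notMem g (hH₀.subset hg) hgH (mem_reachSet.1 h)⟩
    by_cases heX : e ∈ leaving H₀ X
    · obtain ⟨h1, h2, h3⟩ :=
        (isUpClosed_reachSet G H₀ e (Sum.inr (V.black e))).exchange hH.subset (X := X)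
        (fun g hg hne h => reachSet_down hg hne h) self_mem_reachSet (hout hH₀)
      have h4 : 1 < (leaving H₀ X).card := Finset.one_lt_card.2
        ⟨g, hgX, e, heX, by rintro rfl; exact hgH hH.mem⟩
      have h5 := hX.weight_eq hH₀.subset
      have h6 := (hR _ h1).1
      have h7 := (hR _ h2).1
      have h8 := hweight (reachSet G H₀ e (Sum.inr (V.black e)) \ X)
      have h9 := h3 (edgeWeight H₀)
      have h10 := hge (Sum.inr (V.black e))
      omega
    · have hXH : X ∈ V.closedSets H := mem_closedSets.2 fun g' hg' hb => by
        by_cases hne : g' = e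
        · by_contra hw
          exact heX (mem_leaving.2 ⟨hH₀.mem, hne ▸ hb, hne ▸ hw⟩)
        · exact reachSet_down hg' hne hb
      have := (hR _ hXH).1
      have := hlt X hX g hgX
      omega

theorem neg_one_pow_mul_self (n : ℕ) : (-1 : ℤ) ^ n * (-1) ^ n = 1 := by
  rw [← mul_pow]; simp

/-- The coefficients of an expansion alternate with the number of components. -/
theorem IsPivotExpansion.sign_pos [Nonempty B] {e : V.E} {G : Finset V.E} {X : Finset V.E →₀ ℤ}
    (h : IsPivotExpansion e G X) (he : e ∈ G) {H : Finset V.E} (hH : X H ≠ 0) :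
    0 < (-1 : ℤ) ^ (V.numComponents H - 1) * (-1) ^ (V.numComponents G - 1) * X H := by
  classical
  have ha := weight_edgeWeight_univ H
  have hsum := h.sum_eq (Φ := fun G => chainSum (edgeWeight H) (V.closedSets G))
    fun G n L _ => isInvariantAt_chainSum _ L
  rw [Finsupp.sum_eq_single H] at hsum
  · rw [chainSum_closedSets ha, chainSum_closedSets ha, if_pos (inRelint_edgeWeight H)] at hsum
    split_ifs at hsum with hG
    · rw [mul_right_comm, mul_comm _ (X H), hsum, neg_one_pow_mul_self]
      exact one_pos
    · exact absurd hsum (mul_ne_zero hH (pow_ne_zero _ (by norm_num)))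
  · intro H' hH' hne
    rw [chainSum_closedSets ha, if_neg, mul_zero]
    exact fun hR => hne ((h.isPivotFace he hH').eq_of_inRelint (h.isPivotFace he hH) hR)
  · simp

/-- Expanding with respect to one pivot after the other yields an iteration whose coefficients
alternate with the number of components. -/
theorem exists_isDecomposition_sign [Nonempty B] (G : Finset V.E) :
    ∃ S, V.IsDecomposition G S ∧ ∀ F, S F ≠ 0 →
      0 < (-1 : ℤ) ^ (V.numComponents F - 1) * (-1) ^ (V.numComponents G - 1) * S F := by
  classical
  -- induction on the number of possible pivots
  obtain ⟨m, hm⟩ : ∃ m, (Finset.univ.filter fun e => ∃ (n : ℕ) (L : V.OrientedLoop G n),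
    L.up (Fin.last n) = e).card = m := ⟨_, rfl⟩
  induction m using Nat.strong_induction_on generalizing G with
  | _ m ih =>
  by_cases hG : V.IsForest G
  · refine ⟨_, .forest G hG, fun F hF => ?_⟩
    rw [Finsupp.single_apply] at hF ⊢
    split_ifs at hF with h
    · subst h
      simp [neg_one_pow_mul_self]
    · exact absurd rfl hF
  obtain ⟨n, ⟨L⟩⟩ : ∃ n, Nonempty (V.OrientedLoop G n) := by
    unfold IsForest at hG
    push Not at hG
    exact hG
  set e := L.up (Fin.last n) with he
  have heG : e ∈ G := L.up_mem _
  obtain ⟨X, hX⟩ := exists_isPivotExpansion e G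
  have hdec : ∀ H, ∃ S, H ⊆ G → (∀ (n : ℕ) (L : V.OrientedLoop H n), L.up (Fin.last n) ≠ e) →
      V.IsDecomposition H S ∧ ∀ F, S F ≠ 0 →
        0 < (-1 : ℤ) ^ (V.numComponents F - 1) * (-1) ^ (V.numComponents H - 1) * S F := by
    intro H
    by_cases hH : H ⊆ G ∧ ∀ (n : ℕ) (L : V.OrientedLoop H n), L.up (Fin.last n) ≠ e
    · have hlt : (Finset.univ.filter fun e => ∃ (n : ℕ) (L : V.OrientedLoop H n),
          L.up (Fin.last n) = e).card < m := by
        rw [← hm]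
        refine Finset.card_lt_card ((Finset.ssubset_iff_of_subset fun e' he' => ?_).2 ⟨e, ?_, ?_⟩)
        · obtain ⟨n', L', hL'⟩ := (Finset.mem_filter.1 he').2
          exact Finset.mem_filter.2 ⟨Finset.mem_univ _, n', ⟨L'.down, L'.up,
            fun i => hH.1 (L'.down_mem i), fun i => hH.1 (L'.up_mem i), L'.white_eq, L'.black_eq,
            L'.down_injective, L'.up_injective, L'.down_ne_up⟩, hL'⟩
        · exact Finset.mem_filter.2 ⟨Finset.mem_univ _, n, L, rfl⟩
        · intro h
          obtain ⟨n', L', hL'⟩ := (Finset.mem_filter.1 h).2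
          exact hH.2 n' L' hL'
      obtain ⟨S, hS⟩ := ih _ hlt H rfl
      exact ⟨S, fun _ _ => hS⟩
    · exact ⟨0, fun h1 h2 => absurd ⟨h1, h2⟩ hH⟩
  choose S hS using hdec
  refine ⟨_, hX.isDecomposition S fun H h1 h2 => (hS H h1 h2).1, fun F hF => ?_⟩
  rw [Finsupp.sum, Finsupp.finsetSum_apply] at hF ⊢
  simp only [Finsupp.smul_apply, smul_eq_mul] at hF ⊢
  rw [Finset.mul_sum]
  refine lt_of_le_of_ne (Finset.sum_nonneg fun H hH => ?_) (Ne.symm ?_)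
  · rw [Finsupp.mem_support_iff] at hH
    obtain ⟨h1, -, h2⟩ := hX.of_ne_zero hH
    by_cases h0 : S H F = 0
    · simp [h0]
    have hpos := mul_pos (hX.sign_pos heG hH) ((hS H h1 h2).2 F h0)
    refine hpos.le.trans_eq ?_
    linear_combination ((-1 : ℤ) ^ (V.numComponents F - 1) * (-1) ^ (V.numComponents G - 1) *
      (X H * S H F)) * neg_one_pow_mul_self (V.numComponents H - 1)
  · rw [← Finset.mul_sum]
    exact mul_ne_zero (mul_ne_zero (pow_ne_zero _ (by norm_num)) (pow_ne_zero _ (by norm_num))) hF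

end BipGraph

/-! ### The graph of a factorization of the long cycle -/

open SetRing BipGraph

theorem cycleAt_apply {n : ℕ} (σ : Equiv.Perm (Fin n)) (x : Fin n) :
    cycleAt σ (σ x) = cycleAt σ x :=
  Quotient.sound (Equiv.Perm.sameCycle_apply_left.2 (Equiv.Perm.SameCycle.refl σ x))

/-- A property that is invariant under the long cycle holds everywhere or nowhere. -/
theorem iff_of_finRotate {k : ℕ} {P : Fin k → Prop} (h : ∀ x, P (finRotate k x) ↔ P x)
    (x y : Fin k) : P x ↔ P y := by
  rcases k with _ | k
  · exact x.elim0
  have h0 : ∀ x, P x ↔ P 0 := by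
    intro x
    induction x using Fin.induction with
    | zero => rfl
    | succ i ih => rw [← ih, ← h i.castSucc, finRotate_apply, Fin.coeSucc_eq_succ]
  rw [h0 x, h0 y]

namespace BipGraph

/-- Cycles are adjacent if and only if they intersect. -/
def IsIntersectionGraph {k : ℕ} {σ₁ σ₂ : Equiv.Perm (Fin k)}
    (V : BipGraph (CycleOf σ₁) (CycleOf σ₂)) : Prop :=
  ∀ w b, (∃ e, V.white e = w ∧ V.black e = b) ↔ ∃ x, cycleAt σ₁ x = w ∧ cycleAt σ₂ x = b

section

variable {k : ℕ} {σ₁ σ₂ : Equiv.Perm (Fin k)}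

theorem isIntersectionGraph_intersectionGraph : (intersectionGraph σ₁ σ₂).IsIntersectionGraph :=
  fun w b => ⟨fun ⟨e, h1, h2⟩ => by
    obtain ⟨x, hx1, hx2⟩ := e.2
    exact ⟨x, hx1.trans h1, hx2.trans h2⟩, fun ⟨x, h1, h2⟩ => ⟨⟨(w, b), x, h1, h2⟩, rfl, rfl⟩⟩

theorem isIntersectionGraph_intersectionMultigraph :
    (intersectionMultigraph σ₁ σ₂).IsIntersectionGraph :=
  fun _ _ => Iff.rfl

variable {V : BipGraph (CycleOf σ₁) (CycleOf σ₂)} [Fintype (CycleOf σ₁)] [Fintype (CycleOf σ₂)]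
  [DecidableEq (CycleOf σ₁)] [DecidableEq (CycleOf σ₂)]

/-- The graph of a factorization of the long cycle is connected. -/
theorem IsIntersectionGraph.eq_empty_or_univ (hV : V.IsIntersectionGraph)
    (hσ : σ₁ * σ₂ = finRotate k) {I : Finset (CycleOf σ₁ ⊕ CycleOf σ₂)}
    (hI : I ∈ complemented (V.closedSets Finset.univ)) : I = ∅ ∨ I = Finset.univ := by
  have hiff : ∀ x, Sum.inr (cycleAt σ₂ x) ∈ I ↔ Sum.inl (cycleAt σ₁ x) ∈ I := fun x => by
    obtain ⟨e, h1, h2⟩ := (hV (cycleAt σ₁ x) (cycleAt σ₂ x)).2 ⟨x, rfl, rfl⟩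
    have := mem_complemented_closedSets.1 hI e (Finset.mem_univ _)
    rwa [h1, h2] at this
  have hrot : ∀ x, Sum.inl (cycleAt σ₁ (finRotate k x)) ∈ I ↔ Sum.inl (cycleAt σ₁ x) ∈ I :=
    fun x => by
      rw [← hσ, Equiv.Perm.mul_apply, cycleAt_apply, ← hiff, cycleAt_apply, hiff]
  have hall := iff_of_finRotate (P := fun x => Sum.inl (cycleAt σ₁ x) ∈ I) hrot
  by_cases h : ∃ x, Sum.inl (cycleAt σ₁ x) ∈ I
  · obtain ⟨x, hx⟩ := h
    right
    refine Finset.eq_univ_of_forall fun v => ?_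
    rcases v with ⟨⟨y⟩⟩ | ⟨⟨y⟩⟩
    · exact (hall x y).1 hx
    · exact (hiff y).2 ((hall x y).1 hx)
  · push Not at h
    left
    refine Finset.eq_empty_of_forall_notMem fun v hv => ?_
    rcases v with ⟨⟨y⟩⟩ | ⟨⟨y⟩⟩
    · exact h y hv
    · exact h y ((hiff y).1 hv)

theorem IsIntersectionGraph.numComponents_eq_one [Nonempty (CycleOf σ₂)]
    (hV : V.IsIntersectionGraph) (hσ : σ₁ * σ₂ = finRotate k) :
    V.numComponents Finset.univ = 1 := by
  have h1 := card_complemented_closedSets (V := V) Finset.univ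
  have h2 : (complemented (V.closedSets Finset.univ)).card ≤ 2 := by
    refine (Finset.card_le_card (t := {∅, Finset.univ}) fun I hI => ?_).trans Finset.card_le_two
    simpa using hV.eq_empty_or_univ hσ hI
  have h3 := numComponents_pos (V := V) Finset.univ
  rw [h1] at h2
  have := (Nat.pow_le_pow_iff_right (a := 2) (m := 1) one_lt_two).1 h2
  omega

/-- Condition (e) means that the functional of the `q`-forests is in the relative interior for the
graph of the factorization. -/
theorem IsIntersectionGraph.inRelint_iff (hV : V.IsIntersectionGraph)
    (hσ : σ₁ * σ₂ = finRotate k) {q : CycleOf σ₂ → ℕ}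
    (hq : ∑ b, (q b - 1) = Fintype.card (CycleOf σ₁)) :
    InRelint (qWeight q) (V.closedSets Finset.univ) ↔ ConditionE σ₁ σ₂ q := by
  classical
  -- the cycles of `σ₁` that intersect `⋃ A`
  let N : Finset (CycleOf σ₂) → Finset (CycleOf σ₁) := fun A =>
    Finset.univ.filter fun c => ∃ x, cycleAt σ₁ x = c ∧ cycleAt σ₂ x ∈ A
  have hN : ∀ A, Nat.card {c : CycleOf σ₁ // ∃ x, cycleAt σ₁ x = c ∧ cycleAt σ₂ x ∈ A} =
      (N A).card := fun A => Nat.subtype_card _ fun _ => by simp [N]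
  have hwt : ∀ I : Finset (CycleOf σ₁ ⊕ CycleOf σ₂), weight (qWeight q) I =
      I.toLeft.card - ((∑ b ∈ I.toRight, (q b - 1) : ℕ) : ℤ) := fun I => by
    rw [weight_qWeight, Nat.cast_sum]
  constructor
  · rintro hR A ⟨b, hb⟩ ⟨c, hc⟩
    have hI : (N A).disjSum A ∈ V.closedSets Finset.univ := mem_closedSets.2 fun e _ h => by
      rw [Finset.inr_mem_disjSum] at h
      rw [Finset.inl_mem_disjSum]
      obtain ⟨x, h1, h2⟩ := (hV _ _).1 ⟨e, rfl, rfl⟩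
      exact Finset.mem_filter.2 ⟨Finset.mem_univ _, x, h1, h2 ▸ h⟩
    have h := hR _ hI
    have hne : weight (qWeight q) ((N A).disjSum A) ≠ 0 := fun h0 => by
      rcases hV.eq_empty_or_univ hσ (mem_complemented.2 ⟨hI, h.2 h0⟩) with h | h
      · exact Finset.notMem_empty (Sum.inr b) (h ▸ Finset.inr_mem_disjSum.2 hb)
      · exact hc (Finset.inr_mem_disjSum.1 (h ▸ Finset.mem_univ (Sum.inr c)))
    have h1 := h.1
    rw [hwt, Finset.toLeft_disjSum, Finset.toRight_disjSum] at h1 hne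
    rw [hN]
    omega
  · intro hE I hI
    have hsub : N I.toRight ⊆ I.toLeft := fun w hw => by
      obtain ⟨x, hx1, hx2⟩ := (Finset.mem_filter.1 hw).2
      obtain ⟨e, h1, h2⟩ := (hV _ _).2 ⟨x, rfl, rfl⟩
      have := mem_closedSets.1 hI e (Finset.mem_univ _)
      rw [h1, h2] at this
      rw [Finset.mem_toLeft, ← hx1]
      exact this (Finset.mem_toRight.1 hx2)
    by_cases hne : I.toRight.Nonempty
    · by_cases hall : ∃ c, c ∉ I.toRight
      · have h1 := hE _ hne hall
        rw [hN] at h1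
        have h2 := Finset.card_le_card hsub
        rw [hwt]
        omega
      · push Not at hall
        have hI' : I = Finset.univ := Finset.eq_univ_of_forall fun v => by
          rcases v with ⟨⟨x⟩⟩ | b
          · exact Finset.mem_toLeft.1 (hsub (Finset.mem_filter.2
              ⟨Finset.mem_univ _, x, rfl, hall _⟩))
          · exact Finset.mem_toRight.1 (hall b)
        subst hI'
        rw [weight_qWeight_univ hq, Finset.compl_univ]
        exact ⟨le_rfl, fun _ => (isSetRing_closedSets _).empty_mem⟩
    · rw [Finset.not_nonempty_iff_eq_empty] at hne
      rw [hwt, hne, Finset.sum_empty, Nat.cast_zero, sub_zero]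
      refine ⟨Nat.cast_nonneg _, fun h0 => ?_⟩
      have : I = ∅ := by
        rw [← Finset.toLeft_disjSum_toRight (u := I), hne,
          Finset.card_eq_zero.1 (Nat.cast_eq_zero.1 h0), Finset.empty_disjSum, Finset.map_empty]
      subst this
      rw [Finset.compl_empty]
      exact (isSetRing_closedSets _).univ_mem

end

end BipGraph

/-- The colours add up to the total number of cycles. -/
theorem IsColoredFactorization.sum_eq {k : ℕ} {s : ℕ →₀ ℕ} {σ₁ σ₂ : Equiv.Perm (Fin k)}
    {q : CycleOf σ₂ → ℕ} (h : IsColoredFactorization s σ₁ σ₂ q) (hs : ∀ i, i < 2 → s i = 0)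
    [Fintype (CycleOf σ₁)] [Fintype (CycleOf σ₂)] :
    ∑ b, (q b - 1) = Fintype.card (CycleOf σ₁) := by
  classical
  have hcolor : ∀ i, 2 ≤ i → (Finset.univ.filter fun c => q c = i).card = s i := fun i hi => by
    rw [← h.card_color i hi]
    exact (Nat.subtype_card _ fun _ => by simp).symm
  have h1 : ∑ b, q b = s.sum fun i m => i * m := by
    rw [← Finset.sum_fiberwise_of_maps_to (s := Finset.univ) (t := s.support) (g := q)]
    · refine Finset.sum_congr rfl fun i hi => ?_
      have hi2 : 2 ≤ i := by
        by_contra hlt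
        exact Finsupp.mem_support_iff.1 hi (hs i (by omega))
      rw [Finset.sum_congr rfl fun b hb => (Finset.mem_filter.1 hb).2, Finset.sum_const,
        hcolor i hi2, smul_eq_mul, mul_comm]
    · intro b _
      rw [Finsupp.mem_support_iff, ← hcolor _ (h.two_le b)]
      exact Finset.card_ne_zero.2 ⟨b, by simp⟩
  have h2 := h.card_total
  rw [← h1, Nat.card_eq_fintype_card, Nat.card_eq_fintype_card] at h2
  have h3 : ∑ b, (q b - 1) + Fintype.card (CycleOf σ₂) = ∑ b, q b := by
    rw [← Finset.card_univ, Finset.card_eq_sum_ones, ← Finset.sum_add_distrib]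
    exact Finset.sum_congr rfl fun b _ => Nat.sub_add_cancel (one_le_two.trans (h.two_le b))
  omega

theorem mainTheorem11 (k : ℕ) (hk : 1 ≤ k) (s : ℕ →₀ ℕ) (hs : ∀ i, i < 2 → s i = 0)
    (σ₁ σ₂ : Equiv.Perm (Fin k))
    (V : BipGraph (CycleOf σ₁) (CycleOf σ₂))
    (hV : V = intersectionGraph σ₁ σ₂ ∨ V = intersectionMultigraph σ₁ σ₂) :
    -- existence of iterations with the sign property
    (σ₁ * σ₂ = finRotate k →
      ∃ S, V.IsDecomposition Finset.univ S ∧ V.HasSignProperty S) ∧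
    ∀ q : CycleOf σ₂ → ℕ, IsColoredFactorization s σ₁ σ₂ q →
      ∀ S, V.IsDecomposition Finset.univ S →
        -- the sum of coefficients, for an arbitrary iteration
        ((ConditionE σ₁ σ₂ q → V.qForestSum q S = (-1) ^ (1 + s.sum fun _ m => m)) ∧
          (¬ ConditionE σ₁ σ₂ q → V.qForestSum q S = 0)) ∧
        -- the individual coefficients, for an iteration with the sign property
        (V.HasSignProperty S →
          (ConditionE σ₁ σ₂ q →
            ∃ F, V.IsQForest q F ∧ S F = (-1) ^ (1 + s.sum fun _ m => m) ∧
              ∀ F', V.IsQForest q F' → S F' ≠ 0 → F' = F) ∧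
          (¬ ConditionE σ₁ σ₂ q → ∀ F, V.IsQForest q F → S F = 0) ∧
          (ConditionE σ₁ σ₂ q ↔ ConditionE5 V q S)) := by
  classical
  have : Fintype (CycleOf σ₁) := Fintype.ofFinite _
  have : Fintype (CycleOf σ₂) := Fintype.ofFinite _
  have : Nonempty (CycleOf σ₂) := ⟨cycleAt σ₂ ⟨0, hk⟩⟩
  have hVi : V.IsIntersectionGraph := by
    rcases hV with rfl | rfl
    · exact isIntersectionGraph_intersectionGraph
    · exact isIntersectionGraph_intersectionMultigraph
  refine ⟨fun hσ => ?_, fun q hq S hS => ?_⟩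
  · obtain ⟨S, hS, hsign⟩ := exists_isDecomposition_sign (V := V) Finset.univ
    refine ⟨S, hS, fun F hF => ?_⟩
    have := hsign F hF
    rwa [hVi.numComponents_eq_one hσ, Nat.sub_self, pow_zero, mul_one] at this
  have hsum := hq.sum_eq hs
  have hQ := hS.qForestSum_eq hsum
  rw [hVi.numComponents_eq_one hq.factorization, Nat.sub_self, pow_zero] at hQ
  simp only [hVi.inRelint_iff hq.factorization hsum] at hQ
  have hpow : (-1 : ℤ) ^ (1 + s.sum fun _ m => m) = (-1) ^ (Nat.card (CycleOf σ₂) - 1) := by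
    rw [← hq.card_black]
    have : 1 + Nat.card (CycleOf σ₂) = Nat.card (CycleOf σ₂) - 1 + 2 := by
      have : 0 < Nat.card (CycleOf σ₂) := Nat.card_pos
      omega
    rw [this, pow_add]
    norm_num
  rw [hpow]
  have hε := neg_one_pow_mul_self (Nat.card (CycleOf σ₂) - 1)
  set ε : ℤ := (-1) ^ (Nat.card (CycleOf σ₂) - 1)
  -- multiplication by `ε` is injective, as `ε * ε = 1`
  have hcancel : ∀ {x y : ℤ}, ε * x = y → x = ε * y := fun h => by
    rw [← h, ← mul_assoc, hε, one_mul]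
  refine ⟨⟨fun hE => ?_, fun hE => ?_⟩, fun hsign => ?_⟩
  · rw [if_pos hE] at hQ
    rw [hcancel hQ, mul_one]
  · rw [if_neg hE] at hQ
    rw [hcancel hQ, mul_zero]
  -- all `q`-forests have the same number of components, hence no cancellation is possible
  have hpos : ∀ F, V.IsQForest q F → S F ≠ 0 → 0 < ε * S F := fun F hF h0 => by
    have := hsign F h0
    rwa [hF.numComponents_eq hsum] at this
  set T := S.support.filter (V.IsQForest q) with hT
  have hmemT : ∀ F, F ∈ T ↔ V.IsQForest q F ∧ S F ≠ 0 := fun F => by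
    rw [hT, Finset.mem_filter, Finsupp.mem_support_iff, and_comm]
  have hQT : ∑ F ∈ T, ε * S F = if ConditionE σ₁ σ₂ q then 1 else 0 := by
    rw [← hQ, qForestSum, Finsupp.sum, ← Finset.sum_filter, Finset.mul_sum]
  have hTpos : ∀ F ∈ T, 0 < ε * S F := fun F hF => hpos F ((hmemT F).1 hF).1 ((hmemT F).1 hF).2
  have hyes : ConditionE σ₁ σ₂ q → ∃ F, V.IsQForest q F ∧ S F = ε ∧
      ∀ F', V.IsQForest q F' → S F' ≠ 0 → F' = F := by
    intro hE
    rw [if_pos hE] at hQT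
    have hcard : T.card = 1 := by
      have h1 : T.card ≤ 1 := by
        have := Finset.card_nsmul_le_sum T (fun F => ε * S F) 1 fun F hF => hTpos F hF
        rw [hQT, nsmul_eq_mul, mul_one] at this
        exact_mod_cast this
      have h2 : T.card ≠ 0 := fun h => by
        rw [Finset.card_eq_zero.1 h, Finset.sum_empty] at hQT
        exact zero_ne_one hQT
      omega
    obtain ⟨F, hF⟩ := Finset.card_eq_one.1 hcard
    rw [hF, Finset.sum_singleton] at hQT
    refine ⟨F, ((hmemT F).1 (by simp [hF])).1, by rw [hcancel hQT, mul_one], fun F' h1 h2 => ?_⟩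
    have := (hmemT F').2 ⟨h1, h2⟩
    rwa [hF, Finset.mem_singleton] at this
  have hno : ¬ ConditionE σ₁ σ₂ q → ∀ F, V.IsQForest q F → S F = 0 := by
    intro hE F hF
    rw [if_neg hE] at hQT
    by_contra h0
    exact (Finset.sum_pos hTpos ⟨F, (hmemT F).2 ⟨hF, h0⟩⟩).ne' hQT
  refine ⟨hyes, hno, fun hE => ?_, fun ⟨F, hF, h1, _⟩ => ?_⟩
  · obtain ⟨F, hF, h1, h2⟩ := hyes hE
    refine ⟨F, hF, ?_, h2⟩
    rw [h1, abs_pow, abs_neg, abs_one, one_pow]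
  · by_contra hE
    rw [hno hE F hF] at h1
    simp at h1
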